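/- Let $n\ge 1$ and let $\mathbb{H}^n=\mathbb{R}^{2n+1}\equiv\mathbb{C}^n\times\mathbb{R}$ be the Heisenberg group with product $[z,t]*[z',t']=[z+z',\,t+t'+\mathrm{Im}(\sum_{i} z_i\overline{z}'_i)]$, with the left-invariant Riemannian metric $\langle\cdot,\cdot\rangle$ for which $X_k=\frac{\partial}{\partial x_k}+y_k\frac{\partial}{\partial t}$, $Y_k=\frac{\partial}{\partial y_k}-x_k\frac{\partial}{\partial t}$ $(k=1,\dots,n)$ and $T=\frac{\partial}{\partial t}$ are orthonormal, with Levi-Civita connection $D$, and with Riemannian volume equal to Lebesgue measure. A vector is horizontal if it lies in the span of the $X_k,Y_k$, and $U_H$ denotes the horizontal part of $U$. The sub-Riemannian perimeter of a Borel set $\Omega\subseteq\mathbb{H}^n$ is $$\mathcal{P}(\Omega)=\sup\Big\{\int_\Omega \mathrm{div}(U)\,dv : U \text{ a } C^1 \text{ horizontal vector field with compact support},\ |U|\le 1\Big\},$$ and $\Omega$ has finite perimeter if $\mathrm{vol}(\Omega)<\infty$ and $\mathcal{P}(\Omega)<\infty$. Let $\Omega$ be a Borel set of finite perimeter. Call $\Omega$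 stationary if, for every $C^1$ vector field $U$ with compact support on $\mathbb{H}^n$ with flow $(\varphi_t)_{t\in\mathbb{R}}$ such that $\mathrm{vol}(\varphi_t(\Omega))$ is constant for $t$ small, the function $\mathcal{P}(t)=\mathcal{P}(\varphi_t(\Omega))$ (is finite for $t$ small and) satisfies $\mathcal{P}'(0)=0$. Suppose that $\Omega$ is bounded by a $C^2$ embedded hypersurface $\Sigma=\partial\Omega$, with $\Omega$ locally on one side of $\Sigma$, and let $N$ be the unit normal vector to $\Sigma$ pointing into $\Omega$. Let $\Sigma_0$ be the set of points $p\in\Sigma$ at which $T_p\Sigma$ is the horizontal hyperplane. On $\Sigma-\Sigma_0$ let $\nu_H=N_H/|N_H|$, and define the mean curvature $H$ by $$-2n\,H(p)=(\mathrm{div}_\Sigma\,\nu_H)(p)=\sum_{i=1}^{2n}\langle D_{e_i}\nu_H,e_i\rangle ,\qquad p\in\Sigma-\Sigma_0,$$ where $\{e_1,\dots,e_{2n}\}$ is any orthonormal basis of $T_p\Sigma$. If $\Omega$ is stationary, then $\Sigma$ has constant mean curvature, that is, $H$ is constant on $\Sigma-\Sigma_0$. -/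

import Mathlib

open MeasureTheory Filter Topology

noncomputable section

namespace Heisenberg

/-- The underlying space `ℝ^{2n+1}` of the Heisenberg group, with coordinates `(x, y, t)`
(so `z = x + i y`). Its topology, smooth structure and Lebesgue measure are the usual ones. -/
abbrev Space (n : ℕ) : Type := (Fin n → ℝ) × (Fin n → ℝ) × ℝ

variable {n : ℕ}

/-- The group law `[z,t] * [z',t'] = [z + z', t + t' + Im (∑ zᵢ conj z'ᵢ)]`. -/
def op (p q : Space n) : Space n :=
  (p.1 + q.1, p.2.1 + q.2.1, p.2.2 + q.2.2 + ∑ k, (p.2.1 k * q.1 k - p.1 k * q.2.1 k))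

/-- `X_k = ∂/∂x_k + y_k ∂/∂t`. -/
def X (k : Fin n) (p : Space n) : Space n := (Pi.single k 1, 0, p.2.1 k)

/-- `Y_k = ∂/∂y_k - x_k ∂/∂t`. -/
def Y (k : Fin n) (p : Space n) : Space n := (0, Pi.single k 1, -p.1 k)

/-- `T = ∂/∂t`. -/
def T (_p : Space n) : Space n := (0, 0, 1)

/-- The tangent vector at `p` with components `c = (a, b, c)` in the frame `X_k, Y_k, T`. -/
def ofFrame (p c : Space n) : Space n :=
  (c.1, c.2.1, c.2.2 + ∑ k, (p.2.1 k * c.1 k - p.1 k * c.2.1 k))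

/-- The components in the frame `X_k, Y_k, T` of the tangent vector `v` at `p`. -/
def toFrame (p v : Space n) : Space n :=
  (v.1, v.2.1, v.2.2 - ∑ k, (p.2.1 k * v.1 k - p.1 k * v.2.1 k))

theorem ofFrame_toFrame (p v : Space n) : ofFrame p (toFrame p v) = v := by
  simp [ofFrame, toFrame]

theorem toFrame_ofFrame (p c : Space n) : toFrame p (ofFrame p c) = c := by
  simp [ofFrame, toFrame]

theorem ofFrame_eq_sum (p c : Space n) :
    ofFrame p c = ∑ k, c.1 k • X k p + ∑ k, c.2.1 k • Y k p + c.2.2 • T p := by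
  refine Prod.ext ?_ (Prod.ext ?_ ?_)
  · funext j
    simp [ofFrame, X, Y, T, Prod.fst_sum, Finset.sum_apply, Pi.single_apply]
  · funext j
    simp [ofFrame, X, Y, T, Prod.fst_sum, Prod.snd_sum, Finset.sum_apply, Pi.single_apply]
  · simp [ofFrame, X, Y, T, Prod.snd_sum, Finset.sum_sub_distrib, mul_comm]
    ring

/-- The frame is left-invariant: it is the image of the standard basis at the identity under the
differential of the left translation by `p`. -/
theorem hasFDerivAt_op (p c : Space n) :
    ∃ L : Space n →L[ℝ] Space n, HasFDerivAt (op p) L 0 ∧ L c = ofFrame p c := by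
  let M : Space n →ₗ[ℝ] Space n :=
    { toFun := ofFrame p
      map_add' := fun c d => by
        refine Prod.ext rfl (Prod.ext rfl ?_)
        simp only [ofFrame, Prod.snd_add, Prod.fst_add, Pi.add_apply, mul_add,
          Finset.sum_sub_distrib, Finset.sum_add_distrib]
        ring
      map_smul' := fun r c => by
        refine Prod.ext rfl (Prod.ext rfl ?_)
        change r * c.2.2 + ∑ k, (p.2.1 k * (r * c.1 k) - p.1 k * (r * c.2.1 k)) =
          r * (c.2.2 + ∑ k, (p.2.1 k * c.1 k - p.1 k * c.2.1 k))
        rw [mul_add, Finset.mul_sum]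
        congr 1
        exact Finset.sum_congr rfl fun k _ => by ring }
  refine ⟨LinearMap.toContinuousLinearMap M, ?_, rfl⟩
  have h : op p = fun q => p + LinearMap.toContinuousLinearMap M q := by
    funext q
    refine Prod.ext rfl (Prod.ext rfl ?_)
    simp [op, M, ofFrame, add_assoc]
  rw [h]
  exact (LinearMap.toContinuousLinearMap M).hasFDerivAt.const_add p

/-- The Riemannian metric at `p` for which `X_k, Y_k, T` are orthonormal. -/
def metric (p v w : Space n) : ℝ :=
  ∑ k, (toFrame p v).1 k * (toFrame p w).1 k
    + ∑ k, (toFrame p v).2.1 k * (toFrame p w).2.1 k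
    + (toFrame p v).2.2 * (toFrame p w).2.2

/-- The modulus `|v|` of a tangent vector `v` at `p`. -/
def modulus (p v : Space n) : ℝ := Real.sqrt (metric p v v)

/-- The horizontal hyperplane at `p`, spanned by the `X_k` and `Y_k`. -/
def horizontal (p : Space n) : Submodule ℝ (Space n) :=
  Submodule.span ℝ (Set.range (fun k => X k p) ∪ Set.range (fun k => Y k p))

/-- The orthogonal projection `v_H` of the tangent vector `v` at `p` to the horizontal
hyperplane. -/
def horizontalPart (p v : Space n) : Space n :=
  ofFrame p ((toFrame p v).1, (toFrame p v).2.1, 0)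

/-- The Levi-Civita connection on constant combinations of the frame:
`D_{X_k} Y_j = -δ T`, `D_{Y_k} X_j = δ T`, `D_{X_k} T = D_T X_k = Y_k`,
`D_{Y_k} T = D_T Y_k = -X_k`, and the other derivatives are zero. -/
def christoffel (u v : Space n) : Space n :=
  (-(v.2.2 • u.2.1) - u.2.2 • v.2.1, v.2.2 • u.1 + u.2.2 • v.1,
    ∑ k, (u.2.1 k * v.1 k - u.1 k * v.2.1 k))

/-- `D_v U` at `p`, for the Levi-Civita connection `D`. -/
def covDeriv (U : Space n → Space n) (p v : Space n) : Space n :=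
  ofFrame p (fderiv ℝ (fun q => toFrame q (U q)) p v
    + christoffel (toFrame p v) (toFrame p (U p)))

/-- The Riemannian divergence of `U`, the trace of `v ↦ D_v U`. -/
def divergence (U : Space n → Space n) (p : Space n) : ℝ :=
  ∑ k, metric p (covDeriv U p (X k p)) (X k p)
    + ∑ k, metric p (covDeriv U p (Y k p)) (Y k p)
    + metric p (covDeriv U p (T p)) (T p)

/-- The frame components of a vector field, differentiated. -/
theorem hasFDerivAt_toFrame {U : Space n → Space n} {p : Space n} (hU : DifferentiableAt ℝ U p) :
    ∃ L : Space n →L[ℝ] Space n, HasFDerivAt (fun q => toFrame q (U q)) L p ∧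
      ∀ v, L v = ((fderiv ℝ U p v).1, (fderiv ℝ U p v).2.1,
        (fderiv ℝ U p v).2.2 - ∑ k, (v.2.1 k * (U p).1 k + p.2.1 k * (fderiv ℝ U p v).1 k
          - v.1 k * (U p).2.1 k - p.1 k * (fderiv ℝ U p v).2.1 k)) := by
  have h := hU.hasFDerivAt
  have hp : HasFDerivAt (fun q : Space n => q) (ContinuousLinearMap.id ℝ (Space n)) p :=
    hasFDerivAt_id p
  have hs : HasFDerivAt
      (fun q : Space n => ∑ k, (q.2.1 k * (U q).1 k - q.1 k * (U q).2.1 k)) _ p :=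
    HasFDerivAt.fun_sum fun (k : Fin n) _ =>
      ((((hasFDerivAt_pi'.1 hp.snd.fst) k).mul ((hasFDerivAt_pi'.1 h.fst) k)).sub
        (((hasFDerivAt_pi'.1 hp.fst) k).mul ((hasFDerivAt_pi'.1 h.snd.fst) k)))
  refine ⟨_, h.fst.prodMk (h.snd.fst.prodMk (h.snd.snd.sub hs)), fun v => ?_⟩
  refine Prod.ext rfl (Prod.ext rfl ?_)
  simp [Finset.sum_add_distrib, mul_comm]
  ring

theorem fderiv_toFrame {U : Space n → Space n} {p : Space n} (hU : DifferentiableAt ℝ U p)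
    (v : Space n) :
    fderiv ℝ (fun q => toFrame q (U q)) p v =
      ((fderiv ℝ U p v).1, (fderiv ℝ U p v).2.1,
        (fderiv ℝ U p v).2.2 - ∑ k, (v.2.1 k * (U p).1 k + p.2.1 k * (fderiv ℝ U p v).1 k
          - v.1 k * (U p).2.1 k - p.1 k * (fderiv ℝ U p v).2.1 k)) := by
  obtain ⟨L, hL, e⟩ := hasFDerivAt_toFrame hU
  rw [hL.fderiv, e]

/-- The connection is torsion-free. -/
theorem covDeriv_sub_covDeriv {U V : Space n → Space n} {p : Space n}
    (hU : DifferentiableAt ℝ U p) (hV : DifferentiableAt ℝ V p) :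
    covDeriv V p (U p) - covDeriv U p (V p) = VectorField.lieBracket ℝ U V p := by
  have e : ∀ c d : Space n, ofFrame p c - ofFrame p d = ofFrame p (c - d) := fun c d => by
    refine Prod.ext rfl (Prod.ext rfl ?_)
    simp only [ofFrame, Prod.snd_sub, Prod.fst_sub, Pi.sub_apply, mul_sub,
      Finset.sum_sub_distrib]
    ring
  rw [covDeriv, covDeriv, e, fderiv_toFrame hV, fderiv_toFrame hU, VectorField.lieBracket]
  refine Prod.ext ?_ (Prod.ext ?_ ?_)
  · funext k
    simp [ofFrame, toFrame, christoffel]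
    ring
  · funext k
    simp [ofFrame, toFrame, christoffel]
    ring
  · simp [ofFrame, toFrame, christoffel, Finset.sum_sub_distrib, Finset.sum_add_distrib, mul_add,
      mul_sub, mul_comm]
    ring

/-- The connection is compatible with the metric. -/
theorem fderiv_metric {U V : Space n → Space n} {p : Space n}
    (hU : DifferentiableAt ℝ U p) (hV : DifferentiableAt ℝ V p) (w : Space n) :
    fderiv ℝ (fun q => metric q (U q) (V q)) p w =
      metric p (covDeriv U p w) (V p) + metric p (U p) (covDeriv V p w) := by
  obtain ⟨L, hL, -⟩ := hasFDerivAt_toFrame hU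
  obtain ⟨M, hM, -⟩ := hasFDerivAt_toFrame hV
  have h1 : HasFDerivAt
      (fun q : Space n => ∑ k, (toFrame q (U q)).1 k * (toFrame q (V q)).1 k) _ p :=
    HasFDerivAt.fun_sum fun (k : Fin n) _ =>
      ((hasFDerivAt_pi'.1 hL.fst) k).mul ((hasFDerivAt_pi'.1 hM.fst) k)
  have h2 : HasFDerivAt
      (fun q : Space n => ∑ k, (toFrame q (U q)).2.1 k * (toFrame q (V q)).2.1 k) _ p :=
    HasFDerivAt.fun_sum fun (k : Fin n) _ =>
      ((hasFDerivAt_pi'.1 hL.snd.fst) k).mul ((hasFDerivAt_pi'.1 hM.snd.fst) k)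
  have e : fderiv ℝ (fun q => metric q (U q) (V q)) p = _ :=
    ((h1.add h2).add (hL.snd.snd.mul hM.snd.snd)).fderiv
  rw [e]
  simp only [metric, covDeriv, toFrame_ofFrame, hL.fderiv, hM.fderiv]
  generalize toFrame p (U p) = u
  generalize toFrame p (V p) = v
  generalize toFrame p w = z
  generalize hl : L w = l
  generalize hm : M w = m
  simp [christoffel, hl, hm, add_mul, mul_add, sub_mul, mul_sub, Finset.sum_add_distrib,
    Finset.sum_sub_distrib, Finset.mul_sum, Finset.sum_mul]
  simp only [mul_comm, mul_left_comm, mul_assoc]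
  ring

/-- The Riemannian divergence is the coordinate divergence. -/
theorem divergence_eq {U : Space n → Space n} {p : Space n} (hU : DifferentiableAt ℝ U p) :
    divergence U p = ∑ k, (fderiv ℝ U p (Pi.single k 1, 0, 0)).1 k
      + ∑ k, (fderiv ℝ U p (0, Pi.single k 1, 0)).2.1 k + (fderiv ℝ U p (0, 0, 1)).2.2 := by
  have hX : ∀ k, fderiv ℝ U p (Pi.single k 1, 0, p.2.1 k) =
      fderiv ℝ U p (Pi.single k 1, 0, 0) + p.2.1 k • fderiv ℝ U p (0, 0, 1) := fun k => by
    rw [← map_smul, ← map_add]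
    simp
  have hY : ∀ k, fderiv ℝ U p (0, Pi.single k 1, -p.1 k) =
      fderiv ℝ U p (0, Pi.single k 1, 0) - p.1 k • fderiv ℝ U p (0, 0, 1) := fun k => by
    rw [← map_smul, ← map_sub]
    simp
  simp only [divergence, metric, covDeriv, toFrame_ofFrame, fderiv_toFrame hU]
  simp [toFrame, christoffel, X, Y, T, Pi.single_apply, hX, hY, Finset.sum_add_distrib]
  ring

/-! ### Volume, perimeter, stationary sets -/

/-- The `C¹` horizontal vector fields `U` with compact support and `|U| ≤ 1`. -/
def IsAdmissible (U : Space n → Space n) : Prop :=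
  ContDiff ℝ 1 U ∧ HasCompactSupport U ∧ (∀ p, U p ∈ horizontal p) ∧ ∀ p, modulus p (U p) ≤ 1

/-- The sub-Riemannian perimeter. The Riemannian volume is Lebesgue measure. Since `U = 0` is
admissible, the supremum is nonnegative and truncating negative integrals does not change it. -/
def perimeter (Ω : Set (Space n)) : ENNReal :=
  ⨆ (U : Space n → Space n) (_ : IsAdmissible U), ENNReal.ofReal (∫ p in Ω, divergence U p)

/-- Borel sets of finite volume and finite perimeter. -/
def IsOfFinitePerimeter (Ω : Set (Space n)) : Prop :=
  MeasurableSet Ω ∧ volume Ω < ⊤ ∧ perimeter Ω < ⊤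

/-- `φ` is the one-parameter group of the vector field `U`. -/
def IsFlow (U : Space n → Space n) (φ : ℝ → Space n → Space n) : Prop :=
  (∀ p, φ 0 p = p) ∧ ∀ p t, HasDerivAt (fun s => φ s p) (U (φ t p)) t

/-- `P'(0) = 0` along every volume preserving variation `Ω_t = φ_t(Ω)` induced by a compactly
supported `C¹` vector field. -/
def IsStationary (Ω : Set (Space n)) : Prop :=
  ∀ (U : Space n → Space n) (φ : ℝ → Space n → Space n),
    ContDiff ℝ 1 U → HasCompactSupport U → IsFlow U φ →
    (∀ᶠ t in 𝓝 (0 : ℝ), volume (φ t '' Ω) = volume Ω) →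
    (∀ᶠ t in 𝓝 (0 : ℝ), perimeter (φ t '' Ω) < ⊤) ∧
      HasDerivAt (fun t => (perimeter (φ t '' Ω)).toReal) 0 0

/-! ### Hypersurfaces and their mean curvature -/

/-- `Ω` is bounded by the `C²` embedded hypersurface `frontier Ω`: near each of its boundary points
`Ω` is, up to boundary points, the side `{f > 0}` of the regular level set `{f = 0}` of a `C²`
function. -/
def HasC2Boundary (Ω : Set (Space n)) : Prop :=
  ∀ p ∈ frontier Ω, ∃ (f : Space n → ℝ) (W : Set (Space n)),
    IsOpen W ∧ p ∈ W ∧ ContDiffOn ℝ 2 f W ∧ (∀ q ∈ W, fderiv ℝ f q ≠ 0) ∧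
      (∀ q ∈ W, 0 < f q → q ∈ Ω) ∧ ∀ q ∈ W, f q < 0 → q ∉ Ω

/-- The tangent space of `S` at `p`: the velocities at `p` of the curves in `S`. -/
def tangentSpace (S : Set (Space n)) (p : Space n) : Set (Space n) :=
  {v | ∃ γ : ℝ → Space n, γ 0 = p ∧ HasDerivAt γ v 0 ∧ ∀ᶠ s in 𝓝 (0 : ℝ), γ s ∈ S}

/-- The points at which the tangent hyperplane is the horizontal one. -/
def singularSet (S : Set (Space n)) : Set (Space n) :=
  {p ∈ S | tangentSpace S p = horizontal p}

/-- On the boundary of `Ω`, `N` is the unit normal vector pointing into `Ω`. If `Ω` is bounded by a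
`C²` hypersurface, this determines `N` on the boundary; values elsewhere play no role. -/
def IsInnerUnitNormal (Ω : Set (Space n)) (N : Space n → Space n) : Prop :=
  ∀ p ∈ frontier Ω, modulus p (N p) = 1 ∧
    (∀ v ∈ tangentSpace (frontier Ω) p, metric p (N p) v = 0) ∧
    ∀ᶠ s in 𝓝[>] (0 : ℝ), p + s • N p ∈ Ω

/-- The horizontal unit normal `ν_H = N_H / |N_H|`. -/
def horizontalNormal (N : Space n → Space n) (p : Space n) : Space n :=
  (modulus p (horizontalPart p (N p)))⁻¹ • horizontalPart p (N p)

/-- The vector field `V` along `S` is differentiable along `S` at `p`, and `D v` is its covariant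
derivative `D_v V` for every tangent vector `v` of `S` at `p`. -/
def HasCovDerivAlong (S : Set (Space n)) (V : Space n → Space n) (p : Space n)
    (D : Space n → Space n) : Prop :=
  ∃ L : Space n →L[ℝ] Space n, HasFDerivWithinAt (fun q => toFrame q (V q)) L S p ∧
    ∀ v ∈ tangentSpace S p,
      D v = ofFrame p (L v + christoffel (toFrame p v) (toFrame p (V p)))

/-- `e` is an orthonormal basis of the tangent space of the hypersurface `S` at `p`, which has
dimension `2n`. -/
def IsTangentONB (S : Set (Space n)) (p : Space n) (e : Fin (2 * n) → Space n) : Prop :=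
  (∀ i, e i ∈ tangentSpace S p) ∧ ∀ i j, metric p (e i) (e j) = if i = j then 1 else 0

/-- `div_S V (p) = d`, where `div_S V (p) = ∑ ⟨D_{e_i} V, e_i⟩` for an orthonormal basis `e` of the
tangent space (the sum does not depend on the basis). -/
def HasDivergenceAlong (S : Set (Space n)) (V : Space n → Space n) (p : Space n) (d : ℝ) : Prop :=
  ∃ (D : Space n → Space n) (e : Fin (2 * n) → Space n),
    HasCovDerivAlong S V p D ∧ IsTangentONB S p e ∧ ∑ i, metric p (D (e i)) (e i) = d

/-- `H` is the mean curvature at `p` of the hypersurface `S` with respect to `N`: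
`-2nH = div_S ν_H`. -/
def HasMeanCurvatureAt (S : Set (Space n)) (N : Space n → Space n) (p : Space n) (H : ℝ) : Prop :=
  HasDivergenceAlong S (horizontalNormal N) p (-2 * (n : ℝ) * H)

/-- The mean curvature of `S` with respect to `N` is constant off the singular set. -/
def HasConstantMeanCurvature (S : Set (Space n)) (N : Space n → Space n) : Prop :=
  ∃ H : ℝ, ∀ p ∈ S \ singularSet S, HasMeanCurvatureAt S N p H

end Heisenberg

end

/-!
A stationary set has constant mean curvature because perimeter is a supremum, so that first-order
lower bounds for it come from single test fields, without any surface measure or first variation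
formula.

Near a boundary point off the singular set, let `f` be a defining function of `Ω` (so `Ω` is
`{f > 0}`), let `ν` be the horizontal unit normal of the level sets of `f`, and let `V = -ν`. Among
horizontal fields of modulus at most `1` the field `V` makes `f` decrease fastest. Replacing an
admissible field `W` by `χ V + (1 - χ) W`, for a cutoff `χ`, therefore does not decrease the integral
of its divergence over `Ω` (`setIntegral_divergence_nonneg`, `IsCalibration.exists_glue`). Hence the
perimeter of `Ω` is a supremum over admissible fields that agree with `V` near the given point. If a
flow moves `Ω` only where the fields agree with `V`, the perimeter grows at least as much as the
integral of `div V` over the moved set.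

Suppose that `div V` is larger near the boundary point `p₁` than near the boundary point `p₂`. In
linear coordinates in which the boundary is a graph, there is a flow, parallel to the last axis, that
adds to the graph a multiple of a fixed bump, so that for small times the volume is exactly an affine
function of time (`exists_isBumpFlow`). Adding volume near `p₁` and removing the same volume near
`p₂` gives a compactly supported `C¹` field whose flow preserves the volume of `Ω` and along which
the perimeter grows at a positive rate, against stationarity (`divergence_calibration_le`). So `div ν`
takes the same value at all boundary points off the singular set.

Finally `div ν` is the divergence of `ν` along the boundary: the divergence is a trace, which may be
computed in an orthonormal basis that contains the normal `N`, and `⟨D_N ν, N⟩ = 0`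
(`metric_covDeriv_horizontalNormal`, `IsDefiningFunction.hasDivergenceAlong`).
-/

noncomputable section

/-! ### Flows of compactly supported fields on the line -/

/-- A bounded globally Lipschitz vector field is complete. -/
theorem exists_integralCurve_of_lipschitz_of_bounded {E : Type*} [NormedAddCommGroup E]
    [NormedSpace ℝ E] [CompleteSpace E] {v : E → E} {K L : NNReal} (hK : LipschitzWith K v)
    (hL : ∀ x, ‖v x‖ ≤ L) (x : E) :
    ∃ γ : ℝ → E, γ 0 = x ∧ ∀ t, HasDerivAt γ (v (γ t)) t := by
  have key : ∀ k : ℕ, ∃ γ : ℝ → E, γ 0 = x ∧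
      ∀ t ∈ Set.Ioo (-(k + 1 : ℝ)) (k + 1), HasDerivAt γ (v (γ t)) t := by
    intro k
    have hk : (0 : ℝ) < k + 1 := by positivity
    have h0 : (0 : ℝ) ∈ Set.Icc (-(k + 1 : ℝ)) (k + 1) := ⟨by linarith, hk.le⟩
    have hp : IsPicardLindelof (fun _ => v) (tmin := -(k + 1 : ℝ)) (tmax := k + 1) ⟨0, h0⟩ x
        (L * (k + 1)) 0 L K :=
      IsPicardLindelof.of_time_independent (fun y _ => hL y) hK.lipschitzOnWith (by simp)
    obtain ⟨γ, h1, h2⟩ := hp.exists_eq_forall_mem_Icc_hasDerivWithinAt₀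
    exact ⟨γ, h1, fun t ht => (h2 t (Set.Ioo_subset_Icc_self ht)).hasDerivAt (Icc_mem_nhds ht.1 ht.2)⟩
  choose γ h1 h2 using key
  -- solutions on nested intervals agree, so that they define a global one
  have agree : ∀ (j k : ℕ) (t : ℝ), |t| < j + 1 → |t| < k + 1 → γ j t = γ k t := by
    intro j k t hj hk
    have hm : (0 : ℝ) < min (j + 1 : ℝ) (k + 1) := lt_min (by positivity) (by positivity)
    have sub : ∀ s ∈ Set.Ioo (-(min (j + 1 : ℝ) (k + 1))) (min (j + 1 : ℝ) (k + 1)),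
        s ∈ Set.Ioo (-(j + 1 : ℝ)) (j + 1) ∧ s ∈ Set.Ioo (-(k + 1 : ℝ)) (k + 1) := fun s hs => by
      have := min_le_left (j + 1 : ℝ) (k + 1)
      have := min_le_right (j + 1 : ℝ) (k + 1)
      exact ⟨⟨by linarith [hs.1], by linarith [hs.2]⟩, ⟨by linarith [hs.1], by linarith [hs.2]⟩⟩
    refine ODE_solution_unique_of_mem_Ioo (v := fun _ => v) (s := fun _ => Set.univ) (K := K)
      (fun _ _ => hK.lipschitzOnWith) (t₀ := 0) ⟨neg_lt_zero.2 hm, hm⟩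
      (fun s hs => ⟨h2 j s (sub s hs).1, trivial⟩) (fun s hs => ⟨h2 k s (sub s hs).2, trivial⟩)
      ((h1 j).trans (h1 k).symm) ?_
    exact abs_lt.1 (lt_min hj hk)
  have hc : ∀ t : ℝ, |t| < (⌈|t|⌉₊ : ℝ) + 1 := fun t => (Nat.le_ceil _).trans_lt (lt_add_one _)
  refine ⟨fun t => γ ⌈|t|⌉₊ t, by simpa using h1 _, fun t => ?_⟩
  have hd := h2 ⌈|t|⌉₊ t (abs_lt.1 (hc t))
  refine hd.congr_of_eventuallyEq ?_
  filter_upwards [(isOpen_lt continuous_abs continuous_const).mem_nhds (hc t)] with s hs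
  exact agree _ _ s (hc s) hs

/-- A `C¹` field `χ` on the line, supported in `[-3r/4, 3r/4]`, whose flow `θ` preserves the order and
is a translation near the origin for small times: `χ` is a bump equal to `1` on `[-r/2, r/2]`. -/
theorem exists_lineFlow {r : ℝ} (hr : 0 < r) :
    ∃ (χ : ℝ → ℝ) (θ : ℝ → ℝ → ℝ), ContDiff ℝ 1 χ ∧ (∀ s, 3 * r / 4 ≤ |s| → χ s = 0) ∧
      (∀ s, θ 0 s = s) ∧ (∀ s τ, HasDerivAt (fun σ => θ σ s) (χ (θ τ s)) τ) ∧
      (∀ τ s, 3 * r / 4 ≤ |s| → θ τ s = s) ∧ (∀ τ, StrictMono (θ τ)) ∧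
      (∀ τ, Function.Surjective (θ τ)) ∧
      ∀ s τ, |s| ≤ r / 4 → |τ| < r / 4 → θ τ s = s + τ := by
  let b : ContDiffBump (0 : ℝ) := ⟨r / 2, 3 * r / 4, by positivity, by linarith⟩
  have hb1 : ContDiff ℝ 1 (b : ℝ → ℝ) := b.contDiff
  have hb0 : ∀ s, 3 * r / 4 ≤ |s| → b s = 0 := fun s hs =>
    b.zero_of_le_dist (by simpa [Real.dist_eq] using hs)
  obtain ⟨K, hK⟩ := hb1.lipschitzWith_of_hasCompactSupport b.hasCompactSupport one_ne_zero
  choose γ h0 hd using exists_integralCurve_of_lipschitz_of_bounded (L := 1) hK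
    (fun x => by simpa [abs_of_nonneg (b.nonneg' x)] using b.le_one)
  have uniq : ∀ (s : ℝ) (g : ℝ → ℝ) (t₀ : ℝ), (∀ t, HasDerivAt g (b (g t)) t) → γ s t₀ = g t₀ →
      γ s = g := fun s g t₀ hg e =>
    ODE_solution_unique_univ (v := fun _ => b) (s := fun _ => Set.univ) (K := K)
      (fun _ => hK.lipschitzOnWith) (fun t => ⟨hd s t, trivial⟩) (fun t => ⟨hg t, trivial⟩) e
  have group : ∀ s σ τ, γ (γ s σ) τ = γ s (σ + τ) := fun s σ τ => by
    have := uniq (γ s σ) (fun τ => γ s (σ + τ)) 0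
      (fun t => (hd s (σ + t)).comp_const_add σ t) (by simp [h0])
    exact congrFun this τ
  refine ⟨b, fun τ s => γ s τ, hb1, hb0, h0, hd, fun τ s hs => ?_, fun τ => ?_, fun τ s => ?_,
    fun s τ hs hτ => ?_⟩
  · have := uniq s (fun _ => s) 0 (fun t => by simpa [hb0 s hs] using hasDerivAt_const t s) (h0 s)
    exact congrFun this τ
  · intro s s' hss
    by_contra hlt
    -- trajectories that change their order meet, and then they coincide
    have hlt : γ s' τ - γ s τ ≤ 0 := by simpa using hlt
    have hcont : Continuous fun σ => γ s' σ - γ s σ :=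
      (continuous_iff_continuousAt.2 fun t => (hd s' t).continuousAt).sub
        (continuous_iff_continuousAt.2 fun t => (hd s t).continuousAt)
    obtain ⟨σ, hσ⟩ : (0 : ℝ) ∈ Set.range fun σ => γ s' σ - γ s σ :=
      mem_range_of_exists_le_of_exists_ge hcont ⟨τ, hlt⟩ ⟨0, by simpa [h0] using hss.le⟩
    have e := uniq s (γ s') σ (hd s') (sub_eq_zero.1 hσ).symm
    have := congrFun e 0
    rw [h0, h0] at this
    exact hss.ne this
  · exact ⟨γ s (-τ), by simp [group, h0]⟩
  · have h4 : (0 : ℝ) < r / 4 := by positivity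
    refine ODE_solution_unique_of_mem_Ioo (v := fun _ => b) (s := fun _ => Set.univ) (K := K)
      (a := -(r / 4)) (b := r / 4) (g := fun τ => s + τ)
      (fun _ _ => hK.lipschitzOnWith) (t₀ := 0) ⟨neg_lt_zero.2 h4, h4⟩
      (fun t _ => ⟨hd s t, trivial⟩) (fun t ht => ⟨?_, trivial⟩) (by simp [h0]) (abs_lt.1 hτ)
    have h1 : b (s + t) = 1 := b.one_of_mem_closedBall (by
      have := abs_add_le s t
      have := abs_lt.2 ht
      simp only [Metric.mem_closedBall, Real.dist_eq, sub_zero, b]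
      linarith)
    rw [h1]
    simpa using (hasDerivAt_id t).const_add s

/-! ### Bumps along a regular level set -/

/-- `φ` is the flow of a compactly supported `C¹` field `U` that lives in the open set `C` and
pushes the level set `{F = 0}` towards `{F < 0}`. Up to null sets, `φ t` carries the
superlevel set `{F > 0}` in `C` to `S t`, and the volume of `S t` is an affine function of `t` with
slope `m`, for `|t| < ε`. -/
structure IsBumpFlow {E : Type*} [NormedAddCommGroup E] [NormedSpace ℝ E] [MeasurableSpace E]
    (μ : Measure E) (F : E → ℝ) (C : Set E) (U : E → E) (φ : ℝ → E → E) (S : ℝ → Set E)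
    (m ε : ℝ) : Prop where
  isOpen : IsOpen C
  measure_lt_top : μ C < ⊤
  contDiff : ContDiff ℝ 1 U
  hasCompactSupport : HasCompactSupport U
  eq_zero : ∀ z ∉ C, U z = 0
  flow_zero : ∀ z, φ 0 z = z
  hasDerivAt : ∀ z t, HasDerivAt (fun s => φ s z) (U (φ t z)) t
  flow_eq : ∀ t, ∀ z ∉ C, φ t z = z
  flow_mem : ∀ t, ∀ z ∈ C, φ t z ∈ C
  slope_pos : 0 < m
  time_pos : 0 < ε
  measurableSet : ∀ t, MeasurableSet (S t)
  subset : ∀ t, |t| < ε → S t ⊆ C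
  mono : ∀ s t, s ≤ t → S s ⊆ S t
  volume_eq : ∀ t, |t| < ε → μ.real (S t) = μ.real (S 0) + m * t
  image_ae_eq : ∀ t, |t| < ε → ∀ A : Set E, (∀ z ∈ C, 0 < F z → z ∈ A) →
    (∀ z ∈ C, F z < 0 → z ∉ A) → (φ t '' A ∩ C : Set E) =ᵐ[μ] S t

/-- In `K × ℝ`, if `F` decreases along the last axis, then `{F = 0}` is a graph `s = u w`, and the
field `a(w) χ(s) ∂_s`, for bumps `a` and `χ`, moves it to the graph of `u + t a` for small `t`. The
volume below this graph is affine in `t`, with slope `∫ a`. -/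
theorem isBumpFlow_of_graph {K : Type*} [NormedAddCommGroup K] [NormedSpace ℝ K]
    [FiniteDimensional ℝ K] [MeasurableSpace K] [BorelSpace K] (ν : Measure K) [ν.IsAddHaarMeasure]
    {F : K × ℝ → ℝ} {ρ r : ℝ} (hρ : 0 < ρ) (hr : 0 < r)
    (hF : ContinuousOn F (Metric.ball 0 ρ ×ˢ Set.Ioo (-r) r))
    (hanti : ∀ w ∈ Metric.ball (0 : K) ρ, StrictAntiOn (fun s => F (w, s)) (Set.Ioo (-r) r))
    (hpos : ∀ w ∈ Metric.ball (0 : K) ρ, 0 < F (w, -(r / 4)))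
    (hneg : ∀ w ∈ Metric.ball (0 : K) ρ, F (w, r / 4) < 0) :
    ∃ U φ S m ε, IsBumpFlow (ν.prod volume) F (Metric.ball 0 ρ ×ˢ Set.Ioo (-r) r) U φ S m ε := by
  obtain ⟨χ, θ, hχ, hχ0, hθ0, hθ, hθfix, hθmono, hθsurj, hθadd⟩ := exists_lineFlow hr
  let a : ContDiffBump (0 : K) := ⟨ρ / 3, ρ / 2, by positivity, by linarith⟩
  have ha0 : ∀ w, ρ / 2 ≤ ‖w‖ → a w = 0 := fun w hw => a.zero_of_le_dist (by simpa using hw)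
  have ha0' : ∀ w, w ∉ Metric.ball (0 : K) ρ → a w = 0 := fun w hw => ha0 w (by
    have : ρ ≤ ‖w‖ := by simpa using hw
    linarith)
  -- the level set is the graph of `u`
  have hu : ∀ w, ∃ u : ℝ, |u| < r / 4 ∧ (w ∈ Metric.ball (0 : K) ρ → F (w, u) = 0) ∧
      (w ∉ Metric.ball (0 : K) ρ → u = 0) := by
    intro w
    by_cases hw : w ∈ Metric.ball (0 : K) ρ
    · have hc : ContinuousOn (fun s => F (w, s)) (Set.Icc (-(r / 4)) (r / 4)) :=
        hF.comp (by fun_prop) fun s hs => ⟨hw, by linarith [hs.1], by linarith [hs.2]⟩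
      obtain ⟨u, hu, hu0⟩ := intermediate_value_Ioo' (by linarith) hc
        (show (0 : ℝ) ∈ _ from ⟨hneg w hw, hpos w hw⟩)
      exact ⟨u, abs_lt.2 hu, fun _ => hu0, fun h => absurd hw h⟩
    · exact ⟨0, by simpa using hr, fun h => absurd h hw, fun _ => rfl⟩
  choose u hu1 hu2 hu3 using hu
  have hus : ∀ w, -r < u w ∧ u w < r := fun w => by
    have := abs_lt.1 (hu1 w)
    exact ⟨by linarith, by linarith⟩
  have hlt : ∀ w ∈ Metric.ball (0 : K) ρ, ∀ s ∈ Set.Ioo (-r) r, (0 < F (w, s) ↔ s < u w) := by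
    intro w hw s hs
    rw [← hu2 w hw]
    exact (hanti w hw).lt_iff_gt (hus w) hs
  have hgt : ∀ w ∈ Metric.ball (0 : K) ρ, ∀ s ∈ Set.Ioo (-r) r, (F (w, s) < 0 ↔ u w < s) := by
    intro w hw s hs
    rw [← hu2 w hw]
    exact (hanti w hw).lt_iff_gt hs (hus w)
  have humeas : Measurable u := by
    refine measurable_of_Ioi fun c => ?_
    by_cases h1 : r / 4 ≤ c
    · convert! MeasurableSet.empty
      ext w
      have := (abs_lt.1 (hu1 w)).2
      simp
      linarith
    by_cases h2 : c ≤ -(r / 4)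
    · convert! MeasurableSet.univ
      ext w
      have := (abs_lt.1 (hu1 w)).1
      simp
      linarith
    push Not at h1 h2
    have hcr : c ∈ Set.Ioo (-r) r := ⟨by linarith, by linarith⟩
    have ho : IsOpen (Metric.ball (0 : K) ρ ∩ (fun w => F (w, c)) ⁻¹' Set.Ioi 0) :=
      ContinuousOn.isOpen_inter_preimage
        (hF.comp (by fun_prop) fun w hw => ⟨hw, hcr⟩) Metric.isOpen_ball isOpen_Ioi
    have : u ⁻¹' Set.Ioi c = (Metric.ball (0 : K) ρ ∩ (fun w => F (w, c)) ⁻¹' Set.Ioi 0) ∪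
        ((Metric.ball (0 : K) ρ)ᶜ ∩ {_w | c < 0}) := by
      ext w
      by_cases hw : w ∈ Metric.ball (0 : K) ρ
      · have := hlt w hw c hcr
        simp only [Set.mem_preimage, Set.mem_Ioi, Set.mem_union, Set.mem_inter_iff, hw, true_and,
          Set.mem_compl_iff, not_true_eq_false, false_and, or_false, this]
      · have := hu3 w hw
        simp [hw, this]
    rw [this]
    exact ho.measurableSet.union (Metric.isOpen_ball.measurableSet.compl.inter
      (MeasurableSet.const _))
  have habs : ∀ t w, |t| < r / 4 → |t * a w| < r / 4 := fun t w ht => by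
    rw [abs_mul, abs_of_nonneg (a.nonneg' w)]
    exact (mul_le_of_le_one_right (abs_nonneg t) a.le_one).trans_lt ht
  have hgmeas : ∀ t : ℝ, Measurable fun w => u w + t * a w := fun t =>
    humeas.add (a.continuous.measurable.const_mul t)
  have hmapIoo : ∀ τ s, (θ τ s ∈ Set.Ioo (-r) r ↔ s ∈ Set.Ioo (-r) r) := fun τ s => by
    have e1 : θ τ (-r) = -r := hθfix τ (-r) (by rw [abs_neg, abs_of_pos hr]; linarith)
    have e2 : θ τ r = r := hθfix τ r (by rw [abs_of_pos hr]; linarith)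
    have h1 := (hθmono τ).lt_iff_lt (a := -r) (b := s)
    have h2 := (hθmono τ).lt_iff_lt (a := s) (b := r)
    rw [e1] at h1
    rw [e2] at h2
    exact and_congr h1 h2
  have hballfin : ν (Metric.ball 0 ρ) < ⊤ := measure_ball_lt_top
  have hint : ∀ g : K → ℝ, Measurable g → (∃ c, ∀ w, |g w| ≤ c) →
      IntegrableOn g (Metric.ball 0 ρ) ν := by
    rintro g hg ⟨c, hc⟩
    have : IsFiniteMeasure (ν.restrict (Metric.ball 0 ρ)) := ⟨by simpa using hballfin⟩
    exact Integrable.of_bound hg.aestronglyMeasurable c (Eventually.of_forall hc)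
  have huint := hint u humeas ⟨r / 4, fun w => (hu1 w).le⟩
  have haint := hint a a.continuous.measurable
    ⟨1, fun w => by rw [abs_of_nonneg (a.nonneg' w)]; exact a.le_one⟩
  have hrint : IntegrableOn (fun _ : K => -r) (Metric.ball 0 ρ) ν :=
    hint _ measurable_const ⟨|-r|, fun _ => le_rfl⟩
  have hvol : ∀ t, |t| < r / 4 → (ν.prod volume).real
      (regionBetween (fun _ => -r) (fun w => u w + t * a w) (Metric.ball 0 ρ)) =
      ∫ w in Metric.ball 0 ρ, (u w - -r) ∂ν + (∫ w in Metric.ball 0 ρ, a w ∂ν) * t := by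
    intro t ht
    have hle : ∀ w, -r ≤ u w + t * a w := fun w => by
      have := (abs_lt.1 (hu1 w)).1
      have := (abs_lt.1 (habs t w ht)).1
      linarith
    rw [measureReal_def, volume_regionBetween_eq_integral (g := fun w => u w + t * a w) hrint
      (huint.add (haint.const_mul t)) measurableSet_ball fun w _ => hle w,
      ENNReal.toReal_ofReal (integral_nonneg fun w => by simpa using sub_nonneg.2 (hle w))]
    have e := integral_add (huint.sub hrint) (haint.mul_const t)
    rw [integral_mul_const] at e
    refine Eq.trans ?_ e
    congr 1
    funext w
    simp only [Pi.sub_apply]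
    ring
  refine ⟨fun z => (0, a z.1 * χ z.2), fun t z => (z.1, θ (t * a z.1) z.2),
    fun t => regionBetween (fun _ => -r) (fun w => u w + t * a w) (Metric.ball 0 ρ),
    ∫ w in Metric.ball 0 ρ, a w ∂ν, r / 4, ?_⟩
  refine
    { isOpen := Metric.isOpen_ball.prod isOpen_Ioo
      measure_lt_top := by
        rw [Measure.prod_prod]
        exact ENNReal.mul_lt_top hballfin (by simp)
      contDiff := contDiff_const.prodMk
        ((a.contDiff.comp contDiff_fst).mul (hχ.comp contDiff_snd))
      hasCompactSupport := ?_
      eq_zero := ?_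
      flow_zero := fun z => by simp [hθ0]
      hasDerivAt := fun z t => ?_
      flow_eq := fun t z hz => ?_
      flow_mem := fun t z hz => ⟨hz.1, (hmapIoo _ _).2 hz.2⟩
      slope_pos := ?_
      time_pos := by positivity
      measurableSet := fun t => measurableSet_regionBetween measurable_const (hgmeas t)
        measurableSet_ball
      subset := fun t ht z hz => ⟨hz.1, hz.2.1, hz.2.2.trans ?_⟩
      mono := fun s t hst z hz => ⟨hz.1, hz.2.1, hz.2.2.trans_le ?_⟩
      volume_eq := fun t ht => by rw [hvol t ht, hvol 0 (by simpa using hr)]; ring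
      image_ae_eq := fun t ht A hA1 hA2 => ?_ }
  · refine HasCompactSupport.intro ((isCompact_closedBall (0 : K) (ρ / 2)).prod
      (isCompact_Icc (a := -(3 * r / 4)) (b := 3 * r / 4))) fun z hz => ?_
    rw [Set.mem_prod, not_and_or] at hz
    rcases hz with hz | hz
    · have : a z.1 = 0 := ha0 _ (by
        have : ρ / 2 < ‖z.1‖ := by simpa using hz
        exact this.le)
      simp [this]
    · have : χ z.2 = 0 := hχ0 _ (by
        by_contra h
        exact hz (abs_le.1 (not_le.1 h).le))
      simp [this]
  · intro z hz
    rw [Set.mem_prod, not_and_or] at hz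
    rcases hz with hz | hz
    · simp [ha0' _ hz]
    · have : χ z.2 = 0 := hχ0 _ (by
        by_contra h
        have := abs_lt.1 (not_le.1 h)
        exact hz ⟨by linarith [this.1], by linarith [this.2]⟩)
      simp [this]
  · have h := (hθ z.2 (t * a z.1)).comp t ((hasDerivAt_id t).mul_const (a z.1))
    refine (hasDerivAt_const t z.1).prodMk (h.congr_deriv ?_)
    simp [mul_comm]
  · rw [Set.mem_prod, not_and_or] at hz
    rcases hz with hz | hz
    · simp [ha0' _ hz, hθ0]
    · rw [hθfix]
      by_contra h
      have := abs_lt.1 (not_le.1 h)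
      exact hz ⟨by linarith [this.1], by linarith [this.2]⟩
  · rw [setIntegral_eq_integral_of_forall_compl_eq_zero fun w hw => ha0' w hw]
    exact a.integral_pos
  · have := (abs_lt.1 (hu1 z.1)).2
    have := (abs_lt.1 (habs t z.1 ht)).2
    linarith
  · have := mul_le_mul_of_nonneg_right hst (a.nonneg' z.1)
    linarith
  · -- the image agrees with the region off the graph of `u + t a`
    have hnull : ∀ᵐ z ∂(ν.prod volume), z.2 ≠ u z.1 + t * a z.1 := by
      have hm : MeasurableSet {z : K × ℝ | z.2 = u z.1 + t * a z.1} :=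
        measurableSet_eq_fun measurable_snd ((hgmeas t).comp measurable_fst)
      rw [ae_iff]
      simp only [ne_eq, not_not]
      rw [Measure.measure_prod_null hm]
      refine Eventually.of_forall fun w => ?_
      have : Prod.mk w ⁻¹' {z : K × ℝ | z.2 = u z.1 + t * a z.1} = {u w + t * a w} := by
        ext s
        simp
      change volume (Prod.mk w ⁻¹' {z : K × ℝ | z.2 = u z.1 + t * a z.1}) = 0
      rw [this]
      simp
    filter_upwards [hnull] with z hz
    obtain ⟨w, s⟩ := z
    refine propext ⟨fun h => ?_, fun h => ?_⟩
    · obtain ⟨⟨⟨w', s₀⟩, hA, he⟩, hC⟩ := h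
      obtain ⟨rfl, rfl⟩ : w' = w ∧ θ (t * a w') s₀ = s := Prod.ext_iff.1 he
      refine ⟨hC.1, hC.2.1, ?_⟩
      by_contra hge
      have hgt' : u w' + t * a w' < θ (t * a w') s₀ := lt_of_le_of_ne (not_lt.1 hge) (Ne.symm hz)
      rw [← hθadd _ _ (hu1 w').le (habs t w' ht), (hθmono _).lt_iff_lt] at hgt'
      have hs₀ := (hmapIoo _ _).1 hC.2
      exact hA2 (w', s₀) ⟨hC.1, hs₀⟩ ((hgt w' hC.1 s₀ hs₀).2 hgt') hA
    · obtain ⟨hw, h1, h2⟩ := h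
      obtain ⟨s₀, rfl⟩ := hθsurj (t * a w) s
      simp only at hw h1 h2
      rw [← hθadd _ _ (hu1 w).le (habs t w ht), (hθmono _).lt_iff_lt] at h2
      have hs₀ : s₀ ∈ Set.Ioo (-r) r := by
        refine ⟨?_, h2.trans (hus w).2⟩
        have e1 : θ (t * a w) (-r) = -r :=
          hθfix _ (-r) (by rw [abs_neg, abs_of_pos hr]; linarith)
        rw [← e1, (hθmono _).lt_iff_lt] at h1
        exact h1
      exact ⟨⟨(w, s₀), hA1 _ ⟨hw, hs₀⟩ ((hlt w hw s₀ hs₀).2 h2), rfl⟩, hw, (hmapIoo _ _).2 hs₀⟩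

theorem IsBumpFlow.transport {E E' : Type*} [NormedAddCommGroup E] [NormedSpace ℝ E]
    [MeasurableSpace E] [BorelSpace E] [NormedAddCommGroup E'] [NormedSpace ℝ E']
    [MeasurableSpace E'] [BorelSpace E'] {μ : Measure E} {μ' : Measure E'} (L : E' ≃L[ℝ] E) (p : E)
    {f : E → ℝ} {C : Set E'} {U : E' → E'} {φ : ℝ → E' → E'} {S : ℝ → Set E'} {m ε : ℝ}
    (hμ : MeasurePreserving (fun x => L.symm (x - p)) μ μ')
    (h : IsBumpFlow μ' (fun z => f (p + L z)) C U φ S m ε) :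
    IsBumpFlow μ f ((fun x => L.symm (x - p)) ⁻¹' C) (fun x => L (U (L.symm (x - p))))
      (fun t x => p + L (φ t (L.symm (x - p)))) (fun t => (fun x => L.symm (x - p)) ⁻¹' S t) m ε := by
  have hc : Continuous fun x => L.symm (x - p) := by fun_prop
  have hL : ∀ z, L.symm (p + L z - p) = z := fun z => by simp
  have hreal : ∀ t, μ.real ((fun x => L.symm (x - p)) ⁻¹' S t) = μ'.real (S t) := fun t => by
    rw [measureReal_def, hμ.measure_preimage (h.measurableSet t).nullMeasurableSet, measureReal_def]
  refine
    { isOpen := h.isOpen.preimage hc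
      measure_lt_top := by
        rw [hμ.measure_preimage h.isOpen.measurableSet.nullMeasurableSet]
        exact h.measure_lt_top
      contDiff := L.contDiff.comp (h.contDiff.comp (L.symm.contDiff.comp
        (contDiff_id.sub contDiff_const)))
      hasCompactSupport := ?_
      eq_zero := fun z hz => by rw [h.eq_zero _ hz, map_zero]
      flow_zero := fun z => by simp [h.flow_zero]
      hasDerivAt := fun z t => ?_
      flow_eq := fun t z hz => by rw [h.flow_eq t _ hz]; simp
      flow_mem := fun t z hz => by
        rw [Set.mem_preimage, hL]
        exact h.flow_mem t _ hz
      slope_pos := h.slope_pos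
      time_pos := h.time_pos
      measurableSet := fun t => (h.measurableSet t).preimage hc.measurable
      subset := fun t ht => Set.preimage_mono (h.subset t ht)
      mono := fun s t hst => Set.preimage_mono (h.mono s t hst)
      volume_eq := fun t ht => by rw [hreal, hreal, h.volume_eq t ht]
      image_ae_eq := fun t ht A hA1 hA2 => ?_ }
  · have h1 : HasCompactSupport fun x => U (L.symm (x - p)) :=
      h.hasCompactSupport.comp_homeomorph
        ((Homeomorph.subRight p).trans L.symm.toHomeomorph)
    exact h1.comp_left (g := L) (map_zero L)
  · rw [hL]
    exact ((L : E' →L[ℝ] E).hasFDerivAt.comp_hasDerivAt t (h.hasDerivAt _ t)).const_add p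
  · have key := h.image_ae_eq t ht ((fun z => p + L z) ⁻¹' A) (fun z hz h0 => hA1 _ (by
      rw [Set.mem_preimage, hL]
      exact hz) h0) (fun z hz h0 => hA2 _ (by
      rw [Set.mem_preimage, hL]
      exact hz) h0)
    refine EventuallyEq.trans (Eq.eventuallyEq ?_) (hμ.quasiMeasurePreserving.preimage_ae_eq key)
    ext x
    refine and_congr_left fun _ => ⟨?_, ?_⟩
    · rintro ⟨y, hy, rfl⟩
      exact ⟨L.symm (y - p), by simpa using hy, by simp⟩
    · rintro ⟨z, hz, e⟩
      exact ⟨p + L z, hz, by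
        change p + L (φ t (L.symm (p + L z - p))) = x
        rw [hL, e]
        simp⟩

/-- Near a regular zero `p` of `f` there is a bump flow: in linear coordinates in which `f`
decreases along the last axis, flow lines are parallel to that axis. -/
theorem exists_isBumpFlow {E : Type*} [NormedAddCommGroup E] [NormedSpace ℝ E]
    [FiniteDimensional ℝ E] [MeasurableSpace E] [BorelSpace E] (μ : Measure E) [μ.IsAddHaarMeasure]
    {f : E → ℝ} {p : E} {O : Set E} (hf : ContDiffAt ℝ 1 f p) (hp : f p = 0)
    (hreg : fderiv ℝ f p ≠ 0) (hO : O ∈ 𝓝 p) :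
    ∃ C U φ S m ε, p ∈ C ∧ C ⊆ O ∧ IsBumpFlow μ f C U φ S m ε := by
  obtain ⟨v₀, hv₀⟩ : ∃ v, fderiv ℝ f p v ≠ 0 := by
    by_contra! h
    exact hreg (ContinuousLinearMap.ext h)
  set ℓ : E →L[ℝ] ℝ := -fderiv ℝ f p with hℓ
  set v : E := (ℓ v₀)⁻¹ • v₀ with hv
  have hℓv : ℓ v = 1 := by
    have : ℓ v₀ ≠ 0 := by simpa [hℓ] using hv₀
    rw [hv, map_smul, smul_eq_mul, inv_mul_cancel₀ this]
  let L : (ℓ.ker × ℝ) ≃L[ℝ] E := (ContinuousLinearEquiv.prodComm ℝ ℓ.ker ℝ).trans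
    (ContinuousLinearEquiv.equivOfRightInverse ℓ (ContinuousLinearMap.toSpanSingleton ℝ v)
      (fun s => by simp [hℓv])).symm
  have hL : ∀ w s, L (w, s) = s • v + w := fun w s => rfl
  -- a scalar multiple of Haar measure on the kernel makes the coordinates volume preserving
  obtain ⟨ν, hν, hμ⟩ : ∃ ν : Measure ℓ.ker, ν.IsAddHaarMeasure ∧
      MeasurePreserving (fun x => L.symm (x - p)) μ (ν.prod volume) := by
    let ν₀ : Measure ℓ.ker := Measure.addHaar
    have h1 : (μ.map L.symm).IsAddHaarMeasure := L.symm.isAddHaarMeasure_map μ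
    have h2 := Measure.isAddLeftInvariant_eq_smul (μ.map L.symm) (ν₀.prod volume)
    have hc := Measure.addHaarScalarFactor_pos_of_isAddHaarMeasure (μ.map L.symm) (ν₀.prod volume)
    refine ⟨(μ.map L.symm).addHaarScalarFactor (ν₀.prod volume) • ν₀,
      Measure.IsAddHaarMeasure.nnreal_smul ν₀ hc.ne', ?_⟩
    rw [Measure.prod_smul_left, ← h2]
    exact (L.symm.continuous.measurable.measurePreserving μ).comp (measurePreserving_sub_right μ p)
  have hgood : ∀ᶠ z in 𝓝 p, z ∈ O ∧ DifferentiableAt ℝ f z ∧ fderiv ℝ f z v < 0 := by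
    have hc : ContinuousAt (fun z => fderiv ℝ f z v) p :=
      ((hf.fderiv_right (m := 0) (by norm_num)).continuousAt).clm_apply continuousAt_const
    have hneg : fderiv ℝ f p v < 0 := by
      have : fderiv ℝ f p v = -ℓ v := by simp [hℓ]
      rw [this, hℓv]
      norm_num
    filter_upwards [hO, (hf.eventually (by simp)).mono fun z hz => hz.differentiableAt one_ne_zero,
      hc.eventually_lt continuousAt_const hneg] with z h1 h2 h3
    exact ⟨h1, h2, h3⟩
  have he : Tendsto (fun z : ℓ.ker × ℝ => p + L z) (𝓝 0) (𝓝 p) := by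
    have : Continuous fun z : ℓ.ker × ℝ => p + L z := by fun_prop
    simpa using this.tendsto 0
  obtain ⟨r, hr, hbox⟩ := Metric.eventually_nhds_iff_ball.1 (he.eventually hgood)
  have hball : ∀ w s, w ∈ Metric.ball (0 : ℓ.ker) r → s ∈ Set.Ioo (-r) r →
      ((w, s) : ℓ.ker × ℝ) ∈ Metric.ball (0 : ℓ.ker × ℝ) r := by
    intro w s hw hs
    rw [← Prod.mk_zero_zero, ← ball_prod_same]
    exact ⟨hw, by simpa [Real.ball_eq_Ioo] using hs⟩
  have hFd : ∀ w s, w ∈ Metric.ball (0 : ℓ.ker) r → s ∈ Set.Ioo (-r) r →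
      HasDerivAt (fun s => f (p + L (w, s))) (fderiv ℝ f (p + L (w, s)) v) s := by
    intro w s hw hs
    have h1 : HasDerivAt (fun s : ℝ => p + L (w, s)) v s := by
      simp only [hL]
      simpa using (((hasDerivAt_id s).smul_const v).add_const (w : E)).const_add p
    exact (hbox _ (hball w s hw hs)).2.1.hasFDerivAt.comp_hasDerivAt s h1
  have hanti : ∀ w ∈ Metric.ball (0 : ℓ.ker) r,
      StrictAntiOn (fun s => f (p + L (w, s))) (Set.Ioo (-r) r) := by
    intro w hw
    refine strictAntiOn_of_deriv_neg (convex_Ioo _ _)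
      (fun s hs => (hFd w s hw hs).continuousAt.continuousWithinAt) fun s hs => ?_
    rw [interior_Ioo] at hs
    rw [(hFd w s hw hs).deriv]
    exact (hbox _ (hball w s hw hs)).2.2
  have hcont : ∀ w s, w ∈ Metric.ball (0 : ℓ.ker) r → s ∈ Set.Ioo (-r) r →
      ContinuousAt (fun z : ℓ.ker × ℝ => f (p + L z)) (w, s) := by
    intro w s hw hs
    have : Continuous fun z : ℓ.ker × ℝ => p + L z := by fun_prop
    exact ContinuousAt.comp (g := f) (hbox _ (hball w s hw hs)).2.1.continuousAt this.continuousAt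
  have h0 : (0 : ℓ.ker) ∈ Metric.ball (0 : ℓ.ker) r := Metric.mem_ball_self hr
  have hr0 : (0 : ℝ) ∈ Set.Ioo (-r) r := ⟨by linarith, hr⟩
  have hr1 : -(r / 4) ∈ Set.Ioo (-r) r := ⟨by linarith, by linarith⟩
  have hr2 : r / 4 ∈ Set.Ioo (-r) r := ⟨by linarith, by linarith⟩
  have hz : f (p + L (0, 0)) = 0 := by simp [hL, hp]
  have hp1 : 0 < f (p + L (0, -(r / 4))) := by
    rw [← hz]
    exact hanti 0 h0 hr1 hr0 (by linarith)
  have hp2 : f (p + L (0, r / 4)) < 0 := by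
    rw [← hz]
    exact hanti 0 h0 hr0 hr2 (by linarith)
  have hw : ∀ᶠ w in 𝓝 (0 : ℓ.ker), w ∈ Metric.ball (0 : ℓ.ker) r ∧
      0 < f (p + L (w, -(r / 4))) ∧ f (p + L (w, r / 4)) < 0 := by
    have c1 : ContinuousAt (fun w : ℓ.ker => f (p + L (w, -(r / 4)))) 0 :=
      ContinuousAt.comp (f := fun w : ℓ.ker => (w, -(r / 4))) (hcont 0 _ h0 hr1) (by fun_prop)
    have c2 : ContinuousAt (fun w : ℓ.ker => f (p + L (w, r / 4))) 0 :=
      ContinuousAt.comp (f := fun w : ℓ.ker => (w, r / 4)) (hcont 0 _ h0 hr2) (by fun_prop)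
    filter_upwards [Metric.ball_mem_nhds 0 hr, continuousAt_const.eventually_lt c1 hp1,
      c2.eventually_lt continuousAt_const hp2] with w h1 h2 h3
    exact ⟨h1, h2, h3⟩
  obtain ⟨ρ, hρ, hρw⟩ := Metric.eventually_nhds_iff_ball.1 hw
  obtain ⟨U, φ, S, m, ε, h⟩ := isBumpFlow_of_graph ν (F := fun z => f (p + L z)) hρ hr
    (fun z hz => (hcont z.1 z.2 (hρw _ hz.1).1 hz.2).continuousWithinAt)
    (fun w hw => hanti w (hρw w hw).1) (fun w hw => (hρw w hw).2.1) fun w hw => (hρw w hw).2.2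
  refine ⟨_, _, _, _, m, ε, ?_, fun x hx => ?_, h.transport L p hμ⟩
  · simpa using ⟨hρ, hr⟩
  have := (hbox _ (hball _ _ (hρw _ hx.1).1 hx.2)).1
  rwa [Prod.mk.eta, L.apply_symm_apply, add_sub_cancel] at this

/-- The level set is null: the superlevel sets `{0 < f}` and `{0 ≤ f}` are both equal to `S 0` in
`C`, up to null sets. -/
theorem IsBumpFlow.ae_ne_zero {E : Type*} [NormedAddCommGroup E] [NormedSpace ℝ E]
    [MeasurableSpace E] {μ : Measure E} {f : E → ℝ} {C : Set E} {U : E → E} {φ : ℝ → E → E}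
    {S : ℝ → Set E} {m ε : ℝ} (h : IsBumpFlow μ f C U φ S m ε) : ∀ᵐ z ∂μ, z ∈ C → f z ≠ 0 := by
  have id0 : ∀ A : Set E, φ 0 '' A = A := fun A => by
    simp [Set.image_congr fun z _ => h.flow_zero z]
  have h0 : |(0 : ℝ)| < ε := by simpa using h.time_pos
  have h1 := h.image_ae_eq 0 h0 {z | 0 < f z} (fun _ _ hz => hz) fun _ _ hz => hz.not_gt
  have h2 := h.image_ae_eq 0 h0 {z | 0 ≤ f z} (fun _ _ hz => hz.le) fun _ _ hz => hz.not_ge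
  rw [id0] at h1 h2
  filter_upwards [h1.trans h2.symm] with z hz hzC h0
  have : (0 < f z ∧ z ∈ C) = (0 ≤ f z ∧ z ∈ C) := hz
  simp [h0, hzC] at this

/-! ### Volume preserving pairs of bumps -/

theorem mul_measureReal_sub_le_setIntegral_sub {E : Type*} [MeasurableSpace E] {μ : Measure E}
    {g : E → ℝ} {S S' : Set E} {β : ℝ} (hg : Integrable g μ) (hS : MeasurableSet S)
    (hS' : MeasurableSet S') (hfin : μ S' < ⊤) (hsub : S ⊆ S') (hβ : ∀ z ∈ S', β ≤ g z) :
    β * (μ.real S' - μ.real S) ≤ ∫ z in S', g z ∂μ - ∫ z in S, g z ∂μ := by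
  rw [← setIntegral_sdiff hS hg.integrableOn hsub, ← measureReal_sdiff hsub hS hfin.ne, mul_comm]
  have hfin' : μ (S' \ S) < ⊤ := (measure_mono Set.sdiff_subset).trans_lt hfin
  rw [← smul_eq_mul, ← setIntegral_const]
  exact setIntegral_mono_on (integrableOn_const hfin'.ne) hg.integrableOn (hS'.diff hS)
    fun z hz => hβ z hz.1

section TwoBumps

variable {E : Type*} [NormedAddCommGroup E] [NormedSpace ℝ E] [MeasurableSpace E]
  {μ : Measure E} {f₁ f₂ : E → ℝ} {C₁ C₂ : Set E} {U₁ U₂ : E → E} {φ₁ φ₂ : ℝ → E → E}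
  {S₁ S₂ : ℝ → Set E} {m₁ m₂ ε₁ ε₂ : ℝ}

theorem IsBumpFlow.flow_mem_iff (h : IsBumpFlow μ f₁ C₁ U₁ φ₁ S₁ m₁ ε₁) (t : ℝ) (z : E) :
    φ₁ t z ∈ C₁ ↔ z ∈ C₁ :=
  ⟨fun hz => by
    by_contra h'
    rw [h.flow_eq t z h'] at hz
    exact h' hz, h.flow_mem t z⟩

theorem IsBumpFlow.measure_lt_top' (h : IsBumpFlow μ f₁ C₁ U₁ φ₁ S₁ m₁ ε₁) {t : ℝ}
    (ht : |t| < ε₁) : μ (S₁ t) < ⊤ :=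
  (measure_mono (h.subset t ht)).trans_lt h.measure_lt_top

/-- The flow of `U₁ - κ U₂`, for two bump flows in disjoint open sets. -/
def pairFlow (C₁ : Set E) (φ₁ φ₂ : ℝ → E → E) (κ : ℝ) (t : ℝ) (z : E) : E :=
  open scoped Classical in if z ∈ C₁ then φ₁ t z else φ₂ (-κ * t) z

theorem pairFlow_zero (h₁ : IsBumpFlow μ f₁ C₁ U₁ φ₁ S₁ m₁ ε₁)
    (h₂ : IsBumpFlow μ f₂ C₂ U₂ φ₂ S₂ m₂ ε₂) (κ : ℝ) (z : E) :
    pairFlow C₁ φ₁ φ₂ κ 0 z = z := by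
  unfold pairFlow
  split_ifs <;> simp [h₁.flow_zero, h₂.flow_zero]

theorem hasDerivAt_pairFlow (h₁ : IsBumpFlow μ f₁ C₁ U₁ φ₁ S₁ m₁ ε₁)
    (h₂ : IsBumpFlow μ f₂ C₂ U₂ φ₂ S₂ m₂ ε₂) (hd : Disjoint C₁ C₂) (κ : ℝ) (z : E) (t : ℝ) :
    HasDerivAt (fun s => pairFlow C₁ φ₁ φ₂ κ s z)
      (U₁ (pairFlow C₁ φ₁ φ₂ κ t z) - κ • U₂ (pairFlow C₁ φ₁ φ₂ κ t z)) t := by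
  unfold pairFlow
  split_ifs with hz
  · have : φ₁ t z ∉ C₂ := hd.notMem_of_mem_left (h₁.flow_mem t z hz)
    simpa [h₂.eq_zero _ this] using h₁.hasDerivAt z t
  · have : φ₂ (-κ * t) z ∉ C₁ := by
      by_cases hz2 : z ∈ C₂
      · exact hd.notMem_of_mem_right (h₂.flow_mem _ z hz2)
      · rwa [h₂.flow_eq _ z hz2]
    rw [h₁.eq_zero _ this, zero_sub, ← neg_smul]
    simpa [Function.comp_def] using
      (h₂.hasDerivAt z (-κ * t)).scomp t ((hasDerivAt_id t).const_mul (-κ))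

/-- Up to null sets, the image of `A` is `A` off the two open sets and the regions `S₁`, `S₂`
in them. -/
theorem image_pairFlow_ae_eq (h₁ : IsBumpFlow μ f₁ C₁ U₁ φ₁ S₁ m₁ ε₁)
    (h₂ : IsBumpFlow μ f₂ C₂ U₂ φ₂ S₂ m₂ ε₂) (hd : Disjoint C₁ C₂) {κ t : ℝ} (ht₁ : |t| < ε₁)
    (ht₂ : |-κ * t| < ε₂) {A : Set E} (hp₁ : ∀ z ∈ C₁, 0 < f₁ z → z ∈ A)
    (hn₁ : ∀ z ∈ C₁, f₁ z < 0 → z ∉ A) (hp₂ : ∀ z ∈ C₂, 0 < f₂ z → z ∈ A)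
    (hn₂ : ∀ z ∈ C₂, f₂ z < 0 → z ∉ A) :
    (pairFlow C₁ φ₁ φ₂ κ t '' A : Set E) =ᵐ[μ]
      ((A \ (C₁ ∪ C₂)) ∪ (S₁ t ∪ S₂ (-κ * t)) : Set E) := by
  have e : pairFlow C₁ φ₁ φ₂ κ t '' A =
      (A \ (C₁ ∪ C₂)) ∪ ((φ₁ t '' A ∩ C₁) ∪ (φ₂ (-κ * t) '' A ∩ C₂)) := by
    ext y
    constructor
    · rintro ⟨z, hz, rfl⟩
      unfold pairFlow
      split_ifs with hz1
      · exact Or.inr (Or.inl ⟨⟨z, hz, rfl⟩, h₁.flow_mem t z hz1⟩)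
      · by_cases hz2 : z ∈ C₂
        · exact Or.inr (Or.inr ⟨⟨z, hz, rfl⟩, h₂.flow_mem _ z hz2⟩)
        · rw [h₂.flow_eq _ z hz2]
          exact Or.inl ⟨hz, fun h => h.elim hz1 hz2⟩
    · rintro (⟨hy, hyC⟩ | ⟨⟨z, hz, rfl⟩, hC⟩ | ⟨⟨z, hz, rfl⟩, hC⟩)
      · rw [Set.mem_union, not_or] at hyC
        exact ⟨y, hy, by simp [pairFlow, hyC.1, h₂.flow_eq _ y hyC.2]⟩
      · exact ⟨z, hz, by simp [pairFlow, (h₁.flow_mem_iff t z).1 hC]⟩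
      · exact ⟨z, hz, by
          simp [pairFlow, hd.notMem_of_mem_right ((h₂.flow_mem_iff _ z).1 hC)]⟩
  rw [e]
  exact (ae_eq_refl _).union ((h₁.image_ae_eq t ht₁ A hp₁ hn₁).union
    (h₂.image_ae_eq _ ht₂ A hp₂ hn₂))

/-- With `κ = m₁ / m₂` the second bump removes the volume that the first one adds. -/
theorem measure_image_pairFlow (h₁ : IsBumpFlow μ f₁ C₁ U₁ φ₁ S₁ m₁ ε₁)
    (h₂ : IsBumpFlow μ f₂ C₂ U₂ φ₂ S₂ m₂ ε₂) (hd : Disjoint C₁ C₂) {t : ℝ} (ht₁ : |t| < ε₁)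
    (ht₂ : |-(m₁ / m₂) * t| < ε₂) {A : Set E}
    (hp₁ : ∀ z ∈ C₁, 0 < f₁ z → z ∈ A)
    (hn₁ : ∀ z ∈ C₁, f₁ z < 0 → z ∉ A) (hp₂ : ∀ z ∈ C₂, 0 < f₂ z → z ∈ A)
    (hn₂ : ∀ z ∈ C₂, f₂ z < 0 → z ∉ A) :
    μ (pairFlow C₁ φ₁ φ₂ (m₁ / m₂) t '' A) =
      μ (A \ (C₁ ∪ C₂)) + ENNReal.ofReal (μ.real (S₁ 0) + μ.real (S₂ 0)) := by
  have d1 : Disjoint (A \ (C₁ ∪ C₂)) (S₁ t ∪ S₂ (-(m₁ / m₂) * t)) :=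
    Set.disjoint_sdiff_left.mono_right (Set.union_subset_union (h₁.subset t ht₁) (h₂.subset _ ht₂))
  have d2 : Disjoint (S₁ t) (S₂ (-(m₁ / m₂) * t)) :=
    hd.mono (h₁.subset t ht₁) (h₂.subset _ ht₂)
  rw [measure_congr (image_pairFlow_ae_eq h₁ h₂ hd ht₁ ht₂ hp₁ hn₁ hp₂ hn₂),
    measure_union d1 ((h₁.measurableSet t).union (h₂.measurableSet _)),
    measure_union d2 (h₂.measurableSet _), ← ofReal_measureReal (h₁.measure_lt_top' ht₁).ne,
    ← ofReal_measureReal (h₂.measure_lt_top' ht₂).ne,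
    ← ENNReal.ofReal_add measureReal_nonneg measureReal_nonneg, h₁.volume_eq t ht₁,
    h₂.volume_eq _ ht₂]
  congr 2
  have := h₂.slope_pos
  field_simp
  ring

theorem setIntegral_image_pairFlow (h₁ : IsBumpFlow μ f₁ C₁ U₁ φ₁ S₁ m₁ ε₁)
    (h₂ : IsBumpFlow μ f₂ C₂ U₂ φ₂ S₂ m₂ ε₂) (hd : Disjoint C₁ C₂) {κ t : ℝ} (ht₁ : |t| < ε₁)
    (ht₂ : |-κ * t| < ε₂) {A : Set E} (hp₁ : ∀ z ∈ C₁, 0 < f₁ z → z ∈ A)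
    (hn₁ : ∀ z ∈ C₁, f₁ z < 0 → z ∉ A) (hp₂ : ∀ z ∈ C₂, 0 < f₂ z → z ∈ A)
    (hn₂ : ∀ z ∈ C₂, f₂ z < 0 → z ∉ A) {g : E → ℝ} (hg : Integrable g μ) :
    ∫ z in pairFlow C₁ φ₁ φ₂ κ t '' A, g z ∂μ =
      ∫ z in A \ (C₁ ∪ C₂), g z ∂μ + (∫ z in S₁ t, g z ∂μ + ∫ z in S₂ (-κ * t), g z ∂μ) := by
  have d1 : Disjoint (A \ (C₁ ∪ C₂)) (S₁ t ∪ S₂ (-κ * t)) :=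
    Set.disjoint_sdiff_left.mono_right (Set.union_subset_union (h₁.subset t ht₁) (h₂.subset _ ht₂))
  have d2 : Disjoint (S₁ t) (S₂ (-κ * t)) := hd.mono (h₁.subset t ht₁) (h₂.subset _ ht₂)
  rw [setIntegral_congr_set (image_pairFlow_ae_eq h₁ h₂ hd ht₁ ht₂ hp₁ hn₁ hp₂ hn₂),
    setIntegral_union d1 ((h₁.measurableSet t).union (h₂.measurableSet _)) hg.integrableOn
      hg.integrableOn,
    setIntegral_union d2 (h₂.measurableSet _) hg.integrableOn hg.integrableOn]

/-- Where volume is added `g` is at least `β₁`, and where the same volume is removed it is at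
most `β₂`. -/
theorem le_setIntegral_image_pairFlow (h₁ : IsBumpFlow μ f₁ C₁ U₁ φ₁ S₁ m₁ ε₁)
    (h₂ : IsBumpFlow μ f₂ C₂ U₂ φ₂ S₂ m₂ ε₂) (hd : Disjoint C₁ C₂) {t : ℝ} (ht : 0 ≤ t)
    (ht₁ : |t| < ε₁) (ht₂ : |-(m₁ / m₂) * t| < ε₂) {A : Set E}
    (hp₁ : ∀ z ∈ C₁, 0 < f₁ z → z ∈ A)
    (hn₁ : ∀ z ∈ C₁, f₁ z < 0 → z ∉ A) (hp₂ : ∀ z ∈ C₂, 0 < f₂ z → z ∈ A)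
    (hn₂ : ∀ z ∈ C₂, f₂ z < 0 → z ∉ A) {g : E → ℝ} (hg : Integrable g μ) {β₁ β₂ : ℝ}
    (hβ₁ : ∀ z ∈ C₁, β₁ ≤ g z) (hβ₂ : ∀ z ∈ C₂, g z ≤ β₂) :
    ∫ z in A, g z ∂μ + (β₁ - β₂) * m₁ * t ≤
      ∫ z in pairFlow C₁ φ₁ φ₂ (m₁ / m₂) t '' A, g z ∂μ := by
  have h01 : |(0 : ℝ)| < ε₁ := by simpa using h₁.time_pos
  have h02 : |(0 : ℝ)| < ε₂ := by simpa using h₂.time_pos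
  have e0 := setIntegral_image_pairFlow h₁ h₂ hd (κ := m₁ / m₂) h01 (by simpa using h02)
    hp₁ hn₁ hp₂ hn₂ hg
  have id0 : pairFlow C₁ φ₁ φ₂ (m₁ / m₂) 0 '' A = A := by
    simp [Set.image_congr fun z _ => pairFlow_zero h₁ h₂ (m₁ / m₂) z]
  rw [id0, mul_zero] at e0
  rw [setIntegral_image_pairFlow h₁ h₂ hd ht₁ ht₂ hp₁ hn₁ hp₂ hn₂ hg, e0]
  have hκ : 0 ≤ m₁ / m₂ := (div_pos h₁.slope_pos h₂.slope_pos).le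
  have i1 := mul_measureReal_sub_le_setIntegral_sub hg (h₁.measurableSet 0) (h₁.measurableSet t)
    (h₁.measure_lt_top' ht₁) (h₁.mono 0 t ht) fun z hz => hβ₁ z (h₁.subset t ht₁ hz)
  have i2 := mul_measureReal_sub_le_setIntegral_sub (β := -β₂) hg.neg
    (h₂.measurableSet (-(m₁ / m₂) * t)) (h₂.measurableSet 0) (h₂.measure_lt_top' h02)
    (h₂.mono _ 0 (by nlinarith)) fun z hz => neg_le_neg (hβ₂ z (h₂.subset 0 h02 hz))
  rw [h₁.volume_eq t ht₁] at i1
  rw [h₂.volume_eq _ ht₂] at i2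
  simp only [Pi.neg_apply, integral_neg] at i2
  have hm : m₂ * (-(m₁ / m₂) * t) = -(m₁ * t) := by
    have := h₂.slope_pos
    field_simp
  rw [hm] at i2
  nlinarith

end TwoBumps

namespace Heisenberg

variable {n : ℕ}

/-! ### The metric in the orthonormal frame -/

theorem toFrame_add (p v w : Space n) : toFrame p (v + w) = toFrame p v + toFrame p w := by
  refine Prod.ext rfl (Prod.ext rfl ?_)
  simp only [toFrame, Prod.snd_add, Prod.fst_add, Pi.add_apply, mul_add, Finset.sum_sub_distrib,
    Finset.sum_add_distrib]
  ring

theorem toFrame_smul (p : Space n) (c : ℝ) (v : Space n) : toFrame p (c • v) = c • toFrame p v := by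
  refine Prod.ext rfl (Prod.ext rfl ?_)
  simp only [toFrame, Prod.smul_snd, Prod.smul_fst, Pi.smul_apply, smul_eq_mul, mul_sub,
    Finset.sum_sub_distrib, Finset.mul_sum, mul_left_comm]

/-- The components of a tangent vector in the frame `X_k, Y_k, T`, as a vector of a Euclidean
space. The Riemannian metric is the pullback of the inner product. -/
def frameVec (p : Space n) : Space n ≃ₗ[ℝ] EuclideanSpace ℝ (Fin n ⊕ Fin n ⊕ Unit) where
  toFun v := WithLp.toLp 2 (Sum.elim (toFrame p v).1
    (Sum.elim (toFrame p v).2.1 fun _ => (toFrame p v).2.2))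
  map_add' v w := by
    ext i
    rcases i with i | i | i <;> simp [toFrame_add]
  map_smul' c v := by
    ext i
    rcases i with i | i | i <;> simp [toFrame_smul]
  invFun w := ofFrame p (fun k => w (.inl k), fun k => w (.inr (.inl k)), w (.inr (.inr ())))
  left_inv v := by
    simpa using ofFrame_toFrame p v
  right_inv w := by
    ext i
    rcases i with i | i | i <;> simp [toFrame_ofFrame]

@[simp] theorem frameVec_inl (p v : Space n) (k : Fin n) :
    frameVec p v (.inl k) = (toFrame p v).1 k := rfl

@[simp] theorem frameVec_inr_inl (p v : Space n) (k : Fin n) :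
    frameVec p v (.inr (.inl k)) = (toFrame p v).2.1 k := rfl

@[simp] theorem frameVec_inr_inr (p v : Space n) (i : Unit) :
    frameVec p v (.inr (.inr i)) = (toFrame p v).2.2 := rfl

theorem metric_eq_inner (p v w : Space n) :
    metric p v w = inner ℝ (frameVec p v) (frameVec p w) := by
  simp [metric, PiLp.inner_apply, mul_comm, add_assoc]

theorem modulus_eq_norm (p v : Space n) : modulus p v = ‖frameVec p v‖ := by
  rw [modulus, metric_eq_inner, real_inner_self_eq_norm_sq, Real.sqrt_sq (norm_nonneg _)]

theorem mem_horizontal {p v : Space n} : v ∈ horizontal p ↔ (toFrame p v).2.2 = 0 := by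
  constructor
  · intro h
    induction h using Submodule.span_induction with
    | mem x hx =>
      rcases hx with ⟨k, rfl⟩ | ⟨k, rfl⟩ <;> simp [toFrame, X, Y, Pi.single_apply]
    | zero => simp [toFrame]
    | add x y _ _ hx hy => rw [toFrame_add, Prod.snd_add, Prod.snd_add, hx, hy, add_zero]
    | smul c x _ hx => rw [toFrame_smul, Prod.smul_snd, Prod.smul_snd, hx, smul_zero]
  · intro h
    rw [← ofFrame_toFrame p v, ofFrame_eq_sum, h, zero_smul, add_zero]
    exact add_mem (sum_mem fun k _ => Submodule.smul_mem _ _ (Submodule.subset_span (.inl ⟨k, rfl⟩)))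
      (sum_mem fun k _ => Submodule.smul_mem _ _ (Submodule.subset_span (.inr ⟨k, rfl⟩)))

theorem modulus_convex {p v w : Space n} {c : ℝ} (h0 : 0 ≤ c) (h1 : c ≤ 1) (hv : modulus p v ≤ 1)
    (hw : modulus p w ≤ 1) : modulus p (v + c • (w - v)) ≤ 1 := by
  rw [modulus_eq_norm] at *
  have e : v + c • (w - v) = (1 - c) • v + c • w := by
    rw [smul_sub, sub_smul, one_smul]
    abel
  rw [e, map_add, map_smul, map_smul]
  refine (norm_add_le _ _).trans ?_
  rw [norm_smul, norm_smul, Real.norm_of_nonneg h0, Real.norm_of_nonneg (sub_nonneg.2 h1)]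
  nlinarith

/-! ### The divergence theorem -/

instance : (volume : Measure (Space n)).IsAddHaarMeasure := by
  have h : (volume : Measure ((Fin n → ℝ) × ℝ)).IsAddHaarMeasure :=
    Measure.prod.instIsAddHaarMeasure (volume : Measure (Fin n → ℝ)) (volume : Measure ℝ)
  exact Measure.prod.instIsAddHaarMeasure (volume : Measure (Fin n → ℝ))
    (volume : Measure ((Fin n → ℝ) × ℝ))

theorem integral_fderiv_apply_eq_zero {E : Type*} [NormedAddCommGroup E] [NormedSpace ℝ E]
    [FiniteDimensional ℝ E] [MeasurableSpace E] [BorelSpace E] (μ : Measure E) [μ.IsAddHaarMeasure]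
    {g : E → ℝ} (hg : ContDiff ℝ 1 g) (hc : HasCompactSupport g) (v : E) :
    ∫ x, fderiv ℝ g x v ∂μ = 0 := by
  have h1 : Integrable (fun x => fderiv ℝ g x v) μ :=
    ((hg.continuous_fderiv one_ne_zero).clm_apply continuous_const).integrable_of_hasCompactSupport
      (hc.fderiv_apply ℝ v)
  have := integral_mul_fderiv_eq_neg_fderiv_mul_of_integrable (μ := μ) (𝕜 := ℝ)
    (f := fun _ : E => (1 : ℝ)) (g := g) (v := v) (by simp) (by simpa using h1)
    (by simpa using hg.continuous.integrable_of_hasCompactSupport hc) (by simp)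
    (fun x _ => hg.differentiable one_ne_zero x)
  simpa using this

theorem continuous_divergence {U : Space n → Space n} (hU : ContDiff ℝ 1 U) :
    Continuous (divergence U) := by
  have e : divergence U = _ := funext fun p => divergence_eq (hU.differentiable one_ne_zero p)
  have := hU.continuous_fderiv one_ne_zero
  rw [e]
  fun_prop

theorem divergence_congr {U V : Space n → Space n} {p : Space n} (h : U =ᶠ[𝓝 p] V) :
    divergence U p = divergence V p := by
  have h1 : (fun q => toFrame q (U q)) =ᶠ[𝓝 p] fun q => toFrame q (V q) :=
    h.mono fun q hq => by simp only [hq]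
  have : ∀ v, covDeriv U p v = covDeriv V p v := fun v => by
    rw [covDeriv, covDeriv, h1.fderiv_eq, h.eq_of_nhds]
  simp only [divergence, this]

theorem divergence_of_eventually_eq_zero {U : Space n → Space n} {p : Space n}
    (h : U =ᶠ[𝓝 p] 0) : divergence U p = 0 := by
  rw [divergence_congr h, divergence_eq (by fun_prop)]
  simp [Pi.zero_def]

theorem divergence_eq_zero_of_notMem {U : Space n → Space n} {p : Space n} (h : p ∉ tsupport U) :
    divergence U p = 0 :=
  divergence_of_eventually_eq_zero (notMem_tsupport_iff_eventuallyEq.1 h)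

theorem hasCompactSupport_divergence {U : Space n → Space n} (hU : HasCompactSupport U) :
    HasCompactSupport (divergence U) :=
  HasCompactSupport.intro hU fun _ hp => divergence_eq_zero_of_notMem hp

theorem integrable_divergence {U : Space n → Space n} (hU : ContDiff ℝ 1 U)
    (hc : HasCompactSupport U) : Integrable (divergence U) :=
  (continuous_divergence hU).integrable_of_hasCompactSupport (hasCompactSupport_divergence hc)

theorem divergence_add {U V : Space n → Space n} {p : Space n} (hU : DifferentiableAt ℝ U p)
    (hV : DifferentiableAt ℝ V p) :
    divergence (fun q => U q + V q) p = divergence U p + divergence V p := by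
  rw [divergence_eq hU, divergence_eq hV, divergence_eq (hU.fun_add hV), fderiv_fun_add hU hV]
  simp only [add_apply, Prod.fst_add, Prod.snd_add, Pi.add_apply,
    Finset.sum_add_distrib]
  ring

theorem sum_coordinates (z : Space n) :
    ∑ k, z.1 k • ((Pi.single k 1, 0, 0) : Space n) + ∑ k, z.2.1 k • ((0, Pi.single k 1, 0) : Space n)
      + z.2.2 • ((0, 0, 1) : Space n) = z := by
  refine Prod.ext ?_ (Prod.ext ?_ ?_)
  · funext j
    simp [Prod.fst_sum, Finset.sum_apply, Pi.single_apply]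
  · funext j
    simp [Prod.fst_sum, Prod.snd_sum, Finset.sum_apply, Pi.single_apply]
  · simp [Prod.snd_sum]

theorem divergence_smul {g : Space n → ℝ} {U : Space n → Space n} {p : Space n}
    (hg : DifferentiableAt ℝ g p) (hU : DifferentiableAt ℝ U p) :
    divergence (fun q => g q • U q) p = g p * divergence U p + fderiv ℝ g p (U p) := by
  rw [divergence_eq hU, divergence_eq (hg.fun_smul hU), fderiv_fun_smul hg hU]
  conv_rhs => rw [← sum_coordinates (U p)]
  simp only [map_add, map_sum, map_smul]
  simp [Finset.sum_add_distrib, mul_add, Finset.mul_sum, mul_comm]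
  ring

theorem integral_divergence_eq_zero {U : Space n → Space n} (hU : ContDiff ℝ 1 U)
    (hc : HasCompactSupport U) : ∫ p, divergence U p = 0 := by
  have hd := fun p => hU.differentiable one_ne_zero p
  have key : ∀ (c : Space n →L[ℝ] ℝ) (v : Space n),
      Integrable (fun p => c (fderiv ℝ U p v)) ∧ ∫ p, c (fderiv ℝ U p v) = 0 := by
    intro c v
    have h1 : ContDiff ℝ 1 fun p => c (U p) := c.contDiff.comp hU
    have h2 : HasCompactSupport fun p => c (U p) := hc.comp_left (g := c) (map_zero c)
    have h3 : ∀ p, c (fderiv ℝ U p v) = fderiv ℝ (fun p => c (U p)) p v := fun p => by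
      have : HasFDerivAt (fun p => c (U p)) (c.comp (fderiv ℝ U p)) p :=
        c.hasFDerivAt.comp p (hd p).hasFDerivAt
      rw [this.fderiv]
      rfl
    simp only [h3]
    exact ⟨((h1.continuous_fderiv one_ne_zero).clm_apply
      continuous_const).integrable_of_hasCompactSupport (h2.fderiv_apply ℝ v),
      integral_fderiv_apply_eq_zero volume h1 h2 v⟩
  let c1 : Fin n → Space n →L[ℝ] ℝ := fun k =>
    (ContinuousLinearMap.proj k).comp (ContinuousLinearMap.fst ℝ (Fin n → ℝ) ((Fin n → ℝ) × ℝ))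
  let c2 : Fin n → Space n →L[ℝ] ℝ := fun k =>
    (ContinuousLinearMap.proj k).comp ((ContinuousLinearMap.fst ℝ (Fin n → ℝ) ℝ).comp
      (ContinuousLinearMap.snd ℝ (Fin n → ℝ) ((Fin n → ℝ) × ℝ)))
  let c3 : Space n →L[ℝ] ℝ := (ContinuousLinearMap.snd ℝ (Fin n → ℝ) ℝ).comp
      (ContinuousLinearMap.snd ℝ (Fin n → ℝ) ((Fin n → ℝ) × ℝ))
  have e : ∀ p, divergence U p = ∑ k, c1 k (fderiv ℝ U p (Pi.single k 1, 0, 0))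
      + ∑ k, c2 k (fderiv ℝ U p (0, Pi.single k 1, 0)) + c3 (fderiv ℝ U p (0, 0, 1)) :=
    fun p => divergence_eq (hd p)
  simp only [e]
  rw [integral_add, integral_add, integral_finsetSum, integral_finsetSum,
    Finset.sum_eq_zero fun k _ => (key (c1 k) _).2, Finset.sum_eq_zero fun k _ => (key (c2 k) _).2,
    (key c3 _).2]
  · simp
  · exact fun k _ => (key (c2 k) _).1
  · exact fun k _ => (key (c1 k) _).1
  · exact integrable_finsetSum _ fun k _ => (key (c1 k) _).1
  · exact integrable_finsetSum _ fun k _ => (key (c2 k) _).1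
  · exact (integrable_finsetSum _ fun k _ => (key (c1 k) _).1).add
      (integrable_finsetSum _ fun k _ => (key (c2 k) _).1)
  · exact (key c3 _).1

end Heisenberg

/-! ### Gluing in a calibration -/

theorem contDiff_of_contDiffOn_of_tsupport_subset {E F : Type*} [NormedAddCommGroup E]
    [NormedSpace ℝ E] [NormedAddCommGroup F] [NormedSpace ℝ F] {k : WithTop ℕ∞} {h : E → F}
    {O : Set E} (hO : IsOpen O) (hh : ContDiffOn ℝ k h O) (hs : tsupport h ⊆ O) :
    ContDiff ℝ k h := by
  rw [contDiff_iff_contDiffAt]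
  intro x
  by_cases hx : x ∈ O
  · exact hh.contDiffAt (hO.mem_nhds hx)
  · exact contDiffAt_const.congr_of_eventuallyEq
      (notMem_tsupport_iff_eventuallyEq.1 fun h => hx (hs h))

theorem ContDiffOn.contDiff_smul {E F : Type*} [NormedAddCommGroup E]
    [NormedSpace ℝ E] [NormedAddCommGroup F] [NormedSpace ℝ F] {k : WithTop ℕ∞} {g : E → ℝ}
    {Z : E → F} {O : Set E} (hg : ContDiffOn ℝ k g O) (hO : IsOpen O) (hZ : ContDiff ℝ k Z)
    (hs : tsupport Z ⊆ O) : ContDiff ℝ k fun z => g z • Z z :=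
  contDiff_of_contDiffOn_of_tsupport_subset hO (hg.smul hZ.contDiffOn)
    ((tsupport_smul_subset_right g Z).trans hs)

theorem tsupport_fun_smul_subset {E F : Type*} [TopologicalSpace E] [NormedAddCommGroup F]
    [NormedSpace ℝ F] (g : E → ℝ) (Z : E → F) : tsupport (fun z => g z • Z z) ⊆ tsupport Z :=
  tsupport_smul_subset_right g Z

namespace Heisenberg

variable {n : ℕ}

/-- If `Ω` is the side `{f > 0}` of a level set near the support of `Z`, and `Z` points out of `Ω`
in the sense that `f` decreases along `Z`, then the total divergence of `Z` over `Ω` is nonnegative.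
The indicator function of `Ω` is approximated by functions of `f`, which decrease along `Z`. -/
theorem setIntegral_divergence_nonneg {Ω O : Set (Space n)} {f : Space n → ℝ}
    {Z : Space n → Space n} (hΩ : MeasurableSet Ω) (hO : IsOpen O) (hf : ContDiffOn ℝ 1 f O)
    (hZ : ContDiff ℝ 1 Z) (hc : HasCompactSupport Z) (hZO : tsupport Z ⊆ O)
    (hp : ∀ z ∈ O, 0 < f z → z ∈ Ω) (hn : ∀ z ∈ O, f z < 0 → z ∉ Ω)
    (hnull : ∀ᵐ z, z ∈ O → f z ≠ 0) (hdf : ∀ z ∈ O, fderiv ℝ f z (Z z) ≤ 0) :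
    0 ≤ ∫ z in Ω, divergence Z z := by
  -- `g k` vanishes where `f ≤ 0` and tends to `1` where `f > 0`
  let g : ℕ → Space n → ℝ := fun k z => Real.smoothTransition (k * f z)
  have hg : ∀ k, ContDiffOn ℝ 1 (g k) O := fun k =>
    Real.smoothTransition.contDiff.comp_contDiffOn (contDiffOn_const.mul hf)
  have hgZ : ∀ k, ContDiff ℝ 1 fun z => g k z • Z z := fun k => (hg k).contDiff_smul hO hZ hZO
  have hgc : ∀ k, HasCompactSupport fun z => g k z • Z z := fun k =>
    hc.of_isClosed_subset (isClosed_tsupport _) (tsupport_fun_smul_subset (g k) Z)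
  have hdsupp : tsupport (divergence Z) ⊆ tsupport Z :=
    closure_minimal (fun z hz => by
      by_contra h
      exact hz (divergence_eq_zero_of_notMem h)) (isClosed_tsupport _)
  have hgd : ∀ k, Continuous fun z => g k z * divergence Z z := fun k => by
    exact (((hg k).of_le zero_le_one).contDiff_smul hO
      (contDiff_zero.2 (continuous_divergence hZ)) (hdsupp.trans hZO)).continuous
  have hgdi : ∀ k, Integrable fun z => g k z * divergence Z z := fun k =>
    (hgd k).integrable_of_hasCompactSupport (hasCompactSupport_divergence hc).mul_left
  have hpt : ∀ k z, divergence (fun z => g k z • Z z) z ≤ g k z * divergence Z z := by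
    intro k z
    by_cases hz : z ∈ O
    · have hfz : DifferentiableAt ℝ f z :=
        (hf.contDiffAt (hO.mem_nhds hz)).differentiableAt one_ne_zero
      have hst : DifferentiableAt ℝ Real.smoothTransition (k * f z) :=
        (Real.smoothTransition.contDiff (n := 1)).differentiable one_ne_zero _
      have hgz : HasFDerivAt (g k) (deriv Real.smoothTransition (k * f z) • (k : ℝ) • fderiv ℝ f z)
          z :=
        HasDerivAt.comp_hasFDerivAt (h₂ := Real.smoothTransition) z hst.hasDerivAt (hfz.hasFDerivAt.const_mul
          (k : ℝ))
      rw [divergence_smul hgz.differentiableAt (hZ.differentiable one_ne_zero z), hgz.fderiv]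
      have h1 : 0 ≤ deriv Real.smoothTransition (k * f z) := Real.smoothTransition.monotone.deriv_nonneg
      have h2 := mul_nonpos_of_nonneg_of_nonpos h1
        (mul_nonpos_of_nonneg_of_nonpos (Nat.cast_nonneg (α := ℝ) k) (hdf z hz))
      simpa using h2
    · have h0 : z ∉ tsupport Z := fun h => hz (hZO h)
      rw [divergence_eq_zero_of_notMem h0, mul_zero, divergence_eq_zero_of_notMem fun h =>
        h0 (tsupport_fun_smul_subset (g k) Z h)]
  have hint : ∀ k, 0 ≤ ∫ z, g k z * divergence Z z := fun k => by
    rw [← integral_divergence_eq_zero (hgZ k) (hgc k)]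
    exact integral_mono (integrable_divergence (hgZ k) (hgc k)) (hgdi k) (hpt k)
  rw [← integral_indicator hΩ]
  suffices ht : Tendsto (fun k => ∫ z, g k z * divergence Z z) atTop
      (𝓝 (∫ z, Ω.indicator (divergence Z) z)) from ge_of_tendsto' ht hint
  refine tendsto_integral_of_dominated_convergence (fun z => ‖divergence Z z‖)
    (fun k => (hgd k).aestronglyMeasurable) (integrable_divergence hZ hc).norm
    (fun k => Eventually.of_forall fun z => ?_) ?_
  · rw [norm_mul, Real.norm_of_nonneg (Real.smoothTransition.nonneg _)]
    exact mul_le_of_le_one_left (norm_nonneg _) (Real.smoothTransition.le_one _)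
  · filter_upwards [hnull] with z hz
    by_cases hzO : z ∈ O
    · rcases lt_or_gt_of_ne (hz hzO) with h | h
      · have : ∀ k, g k z = 0 := fun k => Real.smoothTransition.zero_of_nonpos
          (mul_nonpos_of_nonneg_of_nonpos (Nat.cast_nonneg k) h.le)
        simp [this, hn z hzO h]
      · rw [Set.indicator_of_mem (hp z hzO h)]
        refine tendsto_const_nhds.congr' ?_
        filter_upwards [tendsto_natCast_atTop_atTop.eventually_ge_atTop (f z)⁻¹] with k hk
        have : g k z = 1 := Real.smoothTransition.one_of_one_le (by
          rwa [← inv_le_iff_one_le_mul₀ h])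
        rw [this, one_mul]
    · have h0 : divergence Z z = 0 := divergence_eq_zero_of_notMem fun h => hzO (hZO h)
      simp [h0, Set.indicator]

/-- The field `V` is horizontal of modulus at most `1` in `O`, and among such fields it makes `f`
decrease fastest. -/
structure IsCalibration (f : Space n → ℝ) (V : Space n → Space n) (O : Set (Space n)) : Prop where
  contDiffOn : ContDiffOn ℝ 1 V O
  horizontal : ∀ z ∈ O, V z ∈ horizontal z
  modulus_le : ∀ z ∈ O, modulus z (V z) ≤ 1
  fderiv_le : ∀ z ∈ O, ∀ w ∈ Heisenberg.horizontal z, modulus z w ≤ 1 →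
    fderiv ℝ f z (V z) ≤ fderiv ℝ f z w

/-- An admissible field can be replaced near a boundary point by the calibration without
decreasing its total divergence over `Ω`. -/
theorem IsCalibration.exists_glue {Ω O : Set (Space n)} {f : Space n → ℝ} {V : Space n → Space n}
    (hV : IsCalibration f V O) (hΩ : MeasurableSet Ω) (hO : IsOpen O) (hf : ContDiffOn ℝ 1 f O)
    (hp : ∀ z ∈ O, 0 < f z → z ∈ Ω) (hn : ∀ z ∈ O, f z < 0 → z ∉ Ω)
    (hnull : ∀ᵐ z, z ∈ O → f z ≠ 0) {p : Space n} (hpO : p ∈ O) :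
    ∃ O' ⊆ O, IsOpen O' ∧ p ∈ O' ∧ ∀ W, IsAdmissible W → ∃ W', IsAdmissible W' ∧
      ∫ z in Ω, divergence W z ≤ ∫ z in Ω, divergence W' z ∧ (∀ z ∈ O', W' z = V z) ∧
      ∀ z ∉ O, W' z = W z := by
  obtain ⟨δ, hδ, hδO⟩ := Metric.isOpen_iff.1 hO p hpO
  let χ : ContDiffBump p := ⟨δ / 3, δ / 2, by positivity, by linarith⟩
  have hχO : tsupport χ ⊆ O := by
    rw [χ.tsupport_eq]
    exact (Metric.closedBall_subset_ball (by simp only [χ]; linarith)).trans hδO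
  have hχ1 : ∀ z ∈ Metric.ball p (δ / 3), χ z = 1 := fun z hz =>
    χ.one_of_mem_closedBall (Metric.ball_subset_closedBall hz)
  have hχ0 : ∀ z ∉ O, χ z = 0 := fun z hz => by
    by_contra h
    exact hz (hχO (subset_tsupport _ h))
  refine ⟨Metric.ball p (δ / 3), (Metric.ball_subset_ball (by linarith)).trans hδO,
    Metric.isOpen_ball, Metric.mem_ball_self (by positivity), fun W hW => ?_⟩
  obtain ⟨hW1, hW2, hW3, hW4⟩ := hW
  set Z : Space n → Space n := fun z => χ z • (V z - W z) with hZdef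
  have hZs : tsupport Z ⊆ tsupport χ := tsupport_smul_subset_left _ _
  have hZ : ContDiff ℝ 1 Z := contDiff_of_contDiffOn_of_tsupport_subset hO
    (χ.contDiff.contDiffOn.smul (hV.contDiffOn.sub hW1.contDiffOn)) (hZs.trans hχO)
  have hZc : HasCompactSupport Z := χ.hasCompactSupport.smul_right
  refine ⟨fun z => W z + Z z, ⟨hW1.add hZ, hW2.add hZc, fun z => ?_, fun z => ?_⟩, ?_,
    fun z hz => ?_, fun z hz => ?_⟩
  · by_cases hz : z ∈ O
    · exact add_mem (hW3 z) (Submodule.smul_mem _ _ (sub_mem (hV.horizontal z hz) (hW3 z)))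
    · simpa [hZdef, hχ0 z hz] using hW3 z
  · by_cases hz : z ∈ O
    · exact modulus_convex (χ.nonneg' z) χ.le_one (hW4 z) (hV.modulus_le z hz)
    · simpa [hZdef, hχ0 z hz] using hW4 z
  · have e : ∀ z, divergence (fun z => W z + Z z) z = divergence W z + divergence Z z := fun z =>
      divergence_add (hW1.differentiable one_ne_zero z) (hZ.differentiable one_ne_zero z)
    simp only [e]
    rw [integral_add (integrable_divergence hW1 hW2).integrableOn
      (integrable_divergence hZ hZc).integrableOn]
    have := setIntegral_divergence_nonneg hΩ hO hf hZ hZc (hZs.trans hχO) hp hn hnull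
      fun z hz => by
        rw [hZdef, map_smul, map_sub]
        exact mul_nonpos_of_nonneg_of_nonpos (χ.nonneg' z)
          (sub_nonpos.2 (hV.fderiv_le z hz _ (hW3 z) (hW4 z)))
    linarith
  · simp [hZdef, hχ1 z hz]
  · simp [hZdef, hχ0 z hz]

/-! ### The divergence of the calibration is constant -/

/-- In the open set `O`, the set `Ω` is the side `{f > 0}` of the regular level set `{f = 0}`, up to
points of the level set. -/
structure IsDefiningFunction (Ω : Set (Space n)) (f : Space n → ℝ) (O : Set (Space n)) : Prop where
  isOpen : IsOpen O
  contDiffOn : ContDiffOn ℝ 2 f O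
  fderiv_ne : ∀ z ∈ O, fderiv ℝ f z ≠ 0
  mem_of_pos : ∀ z ∈ O, 0 < f z → z ∈ Ω
  notMem_of_neg : ∀ z ∈ O, f z < 0 → z ∉ Ω

theorem IsDefiningFunction.mono {Ω O O' : Set (Space n)} {f : Space n → ℝ}
    (h : IsDefiningFunction Ω f O) (hO' : IsOpen O') (hsub : O' ⊆ O) :
    IsDefiningFunction Ω f O' :=
  ⟨hO', h.contDiffOn.mono hsub, fun z hz => h.fderiv_ne z (hsub hz),
    fun z hz => h.mem_of_pos z (hsub hz), fun z hz => h.notMem_of_neg z (hsub hz)⟩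

theorem IsDefiningFunction.contDiffAt {Ω O : Set (Space n)} {f : Space n → ℝ}
    (h : IsDefiningFunction Ω f O) {z : Space n} (hz : z ∈ O) : ContDiffAt ℝ 2 f z :=
  h.contDiffOn.contDiffAt (h.isOpen.mem_nhds hz)

theorem IsCalibration.mono {O O' : Set (Space n)} {f : Space n → ℝ} {V : Space n → Space n}
    (h : IsCalibration f V O) (hsub : O' ⊆ O) : IsCalibration f V O' :=
  ⟨h.contDiffOn.mono hsub, fun z hz => h.horizontal z (hsub hz),
    fun z hz => h.modulus_le z (hsub hz), fun z hz => h.fderiv_le z (hsub hz)⟩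

theorem continuousAt_divergence {U : Space n → Space n} {p : Space n} (hU : ContDiffAt ℝ 1 U p) :
    ContinuousAt (divergence U) p := by
  have e : divergence U =ᶠ[𝓝 p] _ := (hU.eventually (by simp)).mono fun q hq =>
    divergence_eq (hq.differentiableAt one_ne_zero)
  rw [continuousAt_congr e]
  have := (hU.fderiv_right (m := 0) (by norm_num)).continuousAt
  fun_prop

/-- Inside any neighborhood of a boundary point the calibration can be glued into all admissible
fields, and there is a bump flow supported where it agrees with the glued fields. -/
theorem IsCalibration.exists_glue_isBumpFlow {Ω O : Set (Space n)} {f : Space n → ℝ}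
    {V : Space n → Space n} (hV : IsCalibration f V O) (hΩ : MeasurableSet Ω)
    (hf : IsDefiningFunction Ω f O) {p : Space n} (hp : p ∈ O) (hfp : f p = 0) :
    ∃ C U φ S m ε, C ⊆ O ∧ IsBumpFlow volume f C U φ S m ε ∧
      ∀ W, IsAdmissible W → ∃ W', IsAdmissible W' ∧
        ∫ z in Ω, divergence W z ≤ ∫ z in Ω, divergence W' z ∧ (∀ z ∈ C, W' z = V z) ∧
        ∀ z ∉ O, W' z = W z := by
  have hc := (hf.contDiffAt hp).of_le one_le_two
  obtain ⟨C₀, U₀, φ₀, S₀, m₀, ε₀, hpC₀, hC₀, hB₀⟩ := exists_isBumpFlow volume hc hfp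
    (hf.fderiv_ne p hp) (hf.isOpen.mem_nhds hp)
  have hf₀ := hf.mono hB₀.isOpen hC₀
  obtain ⟨O', hO'C, hO', hpO', hglue⟩ := (hV.mono hC₀).exists_glue hΩ hB₀.isOpen
    (hf₀.contDiffOn.of_le one_le_two) hf₀.mem_of_pos hf₀.notMem_of_neg hB₀.ae_ne_zero hpC₀
  obtain ⟨C, U, φ, S, m, ε, -, hC, hB⟩ := exists_isBumpFlow volume hc hfp
    (hf.fderiv_ne p hp) (hO'.mem_nhds hpO')
  refine ⟨C, U, φ, S, m, ε, hC.trans (hO'C.trans hC₀), hB, fun W hW => ?_⟩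
  obtain ⟨W', h1, h2, h3, h4⟩ := hglue W hW
  exact ⟨W', h1, h2, fun z hz => h3 z (hC hz), fun z hz => h4 z fun h => hz (hC₀ h)⟩

/-- A function whose right difference quotients at `0` are bounded below by `c > 0` does not have
derivative `0` there. -/
theorem not_hasDerivAt_zero_of_le {P : ℝ → ℝ} {c : ℝ} (hc : 0 < c)
    (h : ∀ᶠ t in 𝓝[>] (0 : ℝ), P 0 + c * t ≤ P t) : ¬ HasDerivAt P 0 0 := by
  intro hP
  refine hc.not_ge (ge_of_tendsto hP.tendsto_slope_zero_right ?_)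
  filter_upwards [h, self_mem_nhdsWithin] with t ht (ht0 : 0 < t)
  rw [zero_add, smul_eq_mul, inv_mul_eq_div, le_div_iff₀ ht0]
  linarith

/-- If the divergence at `p₁` were larger than at `p₂`, moving volume from `p₂` to `p₁` would
increase the perimeter to first order. -/
theorem divergence_calibration_le {Ω O₁ O₂ : Set (Space n)} {f₁ f₂ : Space n → ℝ}
    {V₁ V₂ : Space n → Space n} {p₁ p₂ : Space n} (hfin : IsOfFinitePerimeter Ω)
    (hstat : IsStationary Ω) (hf₁ : IsDefiningFunction Ω f₁ O₁) (hf₂ : IsDefiningFunction Ω f₂ O₂)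
    (hV₁ : IsCalibration f₁ V₁ O₁) (hV₂ : IsCalibration f₂ V₂ O₂) (hp₁ : p₁ ∈ O₁) (hp₂ : p₂ ∈ O₂)
    (hz₁ : f₁ p₁ = 0) (hz₂ : f₂ p₂ = 0) (hne : p₁ ≠ p₂) :
    divergence V₁ p₁ ≤ divergence V₂ p₂ := by
  by_contra! hlt
  obtain ⟨β₂, hβ₂, hβ⟩ := exists_between hlt
  obtain ⟨β₁, hβ₁₂, hβ₁⟩ := exists_between hβ
  -- disjoint neighborhoods on which the divergences are separated by `β₂ < β₁`
  obtain ⟨A₁, A₂, hA₁, hA₂, hpA₁, hpA₂, hdisj⟩ := t2_separation hne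
  have hc₁ := continuousAt_divergence (hV₁.contDiffOn.contDiffAt (hf₁.isOpen.mem_nhds hp₁))
  have hc₂ := continuousAt_divergence (hV₂.contDiffOn.contDiffAt (hf₂.isOpen.mem_nhds hp₂))
  obtain ⟨B₁, hB₁, hBo₁, hpB₁⟩ := eventually_nhds_iff.1 (((hA₁.eventually_mem hpA₁).and
    (hf₁.isOpen.eventually_mem hp₁)).and (continuousAt_const.eventually_lt hc₁ hβ₁))
  obtain ⟨B₂, hB₂, hBo₂, hpB₂⟩ := eventually_nhds_iff.1 (((hA₂.eventually_mem hpA₂).and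
    (hf₂.isOpen.eventually_mem hp₂)).and (hc₂.eventually_lt continuousAt_const hβ₂))
  have hBd : Disjoint B₁ B₂ := hdisj.mono (fun z hz => (hB₁ z hz).1.1) fun z hz => (hB₂ z hz).1.1
  obtain ⟨C₁, U₁, φ₁, S₁, m₁, ε₁, hC₁, h₁, glue₁⟩ :=
    (hV₁.mono fun z hz => (hB₁ z hz).1.2).exists_glue_isBumpFlow hfin.1
      (hf₁.mono hBo₁ fun z hz => (hB₁ z hz).1.2) hpB₁ hz₁
  obtain ⟨C₂, U₂, φ₂, S₂, m₂, ε₂, hC₂, h₂, glue₂⟩ :=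
    (hV₂.mono fun z hz => (hB₂ z hz).1.2).exists_glue_isBumpFlow hfin.1
      (hf₂.mono hBo₂ fun z hz => (hB₂ z hz).1.2) hpB₂ hz₂
  have hd : Disjoint C₁ C₂ := hBd.mono hC₁ hC₂
  have s₁ := hf₁.mono h₁.isOpen (hC₁.trans fun z hz => (hB₁ z hz).1.2)
  have s₂ := hf₂.mono h₂.isOpen (hC₂.trans fun z hz => (hB₂ z hz).1.2)
  set κ := m₁ / m₂ with hκ
  set ψ := pairFlow C₁ φ₁ φ₂ κ with hψ
  have hsmall : ∀ᶠ t in 𝓝 (0 : ℝ), |t| < ε₁ ∧ |-κ * t| < ε₂ := by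
    have c1 : Continuous fun t : ℝ => |t| := continuous_abs
    have c2 : Continuous fun t : ℝ => |-κ * t| := by fun_prop
    exact (c1.continuousAt.eventually_lt continuousAt_const (by simpa using h₁.time_pos)).and
      (c2.continuousAt.eventually_lt continuousAt_const (by simpa using h₂.time_pos))
  have id0 : ψ 0 '' Ω = Ω := by
    simp [hψ, Set.image_congr fun z _ => pairFlow_zero h₁ h₂ κ z]
  have hvol : ∀ᶠ t in 𝓝 (0 : ℝ), volume (ψ t '' Ω) = volume Ω := by
    filter_upwards [hsmall] with t ht
    conv_rhs => rw [← id0]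
    rw [measure_image_pairFlow h₁ h₂ hd ht.1 ht.2 s₁.mem_of_pos s₁.notMem_of_neg s₂.mem_of_pos
      s₂.notMem_of_neg, measure_image_pairFlow h₁ h₂ hd (by simpa using h₁.time_pos)
      (by simpa using h₂.time_pos) s₁.mem_of_pos s₁.notMem_of_neg s₂.mem_of_pos s₂.notMem_of_neg]
  obtain ⟨hPfin, hP⟩ := hstat (fun z => U₁ z - κ • U₂ z) ψ
    (h₁.contDiff.sub (h₂.contDiff.const_smul κ))
    (h₁.hasCompactSupport.sub (h₂.hasCompactSupport.smul_left (f := fun _ => κ)))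
    ⟨pairFlow_zero h₁ h₂ κ, hasDerivAt_pairFlow h₁ h₂ hd κ⟩ hvol
  have hcpos : 0 < (β₁ - β₂) * m₁ := mul_pos (sub_pos.2 hβ₁₂) h₁.slope_pos
  refine not_hasDerivAt_zero_of_le hcpos ?_ hP
  filter_upwards [nhdsWithin_le_nhds hsmall, nhdsWithin_le_nhds hPfin, self_mem_nhdsWithin]
    with t ht hPt (ht0 : 0 < t)
  have key : ∀ W, IsAdmissible W → (∫ z in Ω, divergence W z) + (β₁ - β₂) * m₁ * t ≤
      (perimeter (ψ t '' Ω)).toReal := by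
    intro W hW
    obtain ⟨W₁, hW₁, hle₁, hC₁V, -⟩ := glue₁ W hW
    obtain ⟨W₂, hW₂, hle₂, hC₂V, hoff⟩ := glue₂ W₁ hW₁
    have e₁ : ∀ z ∈ C₁, β₁ ≤ divergence W₂ z := fun z hz => by
      have : W₂ =ᶠ[𝓝 z] V₁ := by
        filter_upwards [h₁.isOpen.mem_nhds hz] with y hy
        rw [hoff y (hBd.notMem_of_mem_left (hC₁ hy)), hC₁V y hy]
      rw [divergence_congr this]
      exact (hB₁ z (hC₁ hz)).2.le
    have e₂ : ∀ z ∈ C₂, divergence W₂ z ≤ β₂ := fun z hz => by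
      have : W₂ =ᶠ[𝓝 z] V₂ := by
        filter_upwards [h₂.isOpen.mem_nhds hz] with y hy
        exact hC₂V y hy
      rw [divergence_congr this]
      exact (hB₂ z (hC₂ hz)).2.le
    have hint := integrable_divergence hW₂.1 hW₂.2.1
    have h3 : (∫ z in Ω, divergence W₂ z) + (β₁ - β₂) * m₁ * t ≤
        ∫ z in ψ t '' Ω, divergence W₂ z :=
      le_setIntegral_image_pairFlow h₁ h₂ hd ht0.le ht.1 ht.2 s₁.mem_of_pos
        s₁.notMem_of_neg s₂.mem_of_pos s₂.notMem_of_neg hint e₁ e₂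
    have h4 : ∫ z in ψ t '' Ω, divergence W₂ z ≤ (perimeter (ψ t '' Ω)).toReal :=
      (ENNReal.ofReal_le_iff_le_toReal hPt.ne).1
        (le_iSup₂_of_le (f := fun (U : Space n → Space n) (_ : IsAdmissible U) =>
          ENNReal.ofReal (∫ p in ψ t '' Ω, divergence U p)) W₂ hW₂ le_rfl)
    linarith
  have h0 : 0 ≤ (perimeter (ψ t '' Ω)).toReal - (β₁ - β₂) * m₁ * t := by
    have hadm : IsAdmissible (0 : Space n → Space n) :=
      ⟨contDiff_const, HasCompactSupport.zero, fun p => zero_mem _, fun p => by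
        simp [modulus_eq_norm]⟩
    have h := key 0 hadm
    have : ∀ z, divergence (0 : Space n → Space n) z = 0 := fun z =>
      divergence_of_eventually_eq_zero (EventuallyEq.refl _ _)
    simp only [this, integral_zero] at h
    linarith
  rw [id0]
  have hP0 : perimeter Ω ≤
      ENNReal.ofReal ((perimeter (ψ t '' Ω)).toReal - (β₁ - β₂) * m₁ * t) :=
    iSup₂_le fun W hW => ENNReal.ofReal_le_ofReal (by linarith [key W hW])
  have := ENNReal.toReal_mono ENNReal.ofReal_ne_top hP0
  rw [ENNReal.toReal_ofReal h0] at this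
  linarith

/-! ### The gradient and the horizontal normal -/

/-- The Riemannian gradient of `f`. -/
def gradient (f : Space n → ℝ) (p : Space n) : Space n :=
  ofFrame p (fun k => fderiv ℝ f p (X k p), fun k => fderiv ℝ f p (Y k p), fderiv ℝ f p (T p))

theorem metric_gradient (f : Space n → ℝ) (p v : Space n) :
    metric p (gradient f p) v = fderiv ℝ f p v := by
  conv_rhs => rw [← ofFrame_toFrame p v, ofFrame_eq_sum]
  simp [metric, gradient, toFrame_ofFrame, mul_comm]

theorem metric_comm (p v w : Space n) : metric p v w = metric p w v := by
  rw [metric_eq_inner, metric_eq_inner, real_inner_comm]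

theorem metric_smul_left (p : Space n) (c : ℝ) (v w : Space n) :
    metric p (c • v) w = c * metric p v w := by
  rw [metric_eq_inner, metric_eq_inner, map_smul, real_inner_smul_left]

theorem modulus_smul (p : Space n) (c : ℝ) (v : Space n) :
    modulus p (c • v) = |c| * modulus p v := by
  rw [modulus_eq_norm, modulus_eq_norm, map_smul, norm_smul, Real.norm_eq_abs]

theorem modulus_pos (p : Space n) {v : Space n} : 0 < modulus p v ↔ v ≠ 0 := by
  rw [modulus_eq_norm, norm_pos_iff]
  exact (frameVec p).map_ne_zero_iff

theorem toFrame_horizontalPart (p v : Space n) :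
    toFrame p (horizontalPart p v) = ((toFrame p v).1, (toFrame p v).2.1, 0) :=
  toFrame_ofFrame _ _

theorem horizontalPart_smul (p : Space n) (c : ℝ) (v : Space n) :
    horizontalPart p (c • v) = c • horizontalPart p v := by
  apply (frameVec p).injective
  rw [map_smul]
  ext i
  rcases i with i | i | i <;> simp [toFrame_horizontalPart, toFrame_smul]

theorem metric_horizontalPart {p v w : Space n} (hw : w ∈ horizontal p) :
    metric p (horizontalPart p v) w = metric p v w := by
  rw [mem_horizontal] at hw
  simp [metric, toFrame_horizontalPart, hw]

theorem horizontalPart_mem (p v : Space n) : horizontalPart p v ∈ horizontal p := by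
  rw [mem_horizontal, toFrame_horizontalPart]

theorem horizontalNormal_mem (G : Space n → Space n) (p : Space n) :
    horizontalNormal G p ∈ horizontal p :=
  Submodule.smul_mem _ _ (horizontalPart_mem p _)

theorem modulus_horizontalNormal {G : Space n → Space n} {p : Space n}
    (h : horizontalPart p (G p) ≠ 0) : modulus p (horizontalNormal G p) = 1 := by
  have := (modulus_pos p).2 h
  rw [horizontalNormal, modulus_smul, abs_of_pos (inv_pos.2 this), inv_mul_cancel₀ this.ne']

/-- The horizontal normal only depends on the direction of the normal. -/
theorem horizontalNormal_congr {N G : Space n → Space n} {p : Space n} {c : ℝ} (hc : 0 < c)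
    (h : N p = c • G p) : horizontalNormal N p = horizontalNormal G p := by
  rw [horizontalNormal, horizontalNormal, h, horizontalPart_smul, modulus_smul, abs_of_pos hc,
    smul_smul, mul_inv_rev, mul_assoc, inv_mul_cancel₀ hc.ne', mul_one]

theorem contDiffAt_toFrame {k : WithTop ℕ∞} {G : Space n → Space n} {p : Space n}
    (hG : ContDiffAt ℝ k G p) : ContDiffAt ℝ k (fun q => toFrame q (G q)) p := by
  unfold toFrame
  fun_prop

theorem contDiffAt_ofFrame {k : WithTop ℕ∞} {G : Space n → Space n} {p : Space n}
    (hG : ContDiffAt ℝ k G p) : ContDiffAt ℝ k (fun q => ofFrame q (G q)) p := by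
  unfold ofFrame
  fun_prop

theorem contDiffAt_gradient {f : Space n → ℝ} {p : Space n} (hf : ContDiffAt ℝ 2 f p) :
    ContDiffAt ℝ 1 (gradient f) p := by
  have h : ContDiffAt ℝ 1 (fderiv ℝ f) p := hf.fderiv_right (by norm_num)
  unfold gradient X Y T
  exact contDiffAt_ofFrame (by fun_prop)

theorem contDiffAt_horizontalPart {G : Space n → Space n} {p : Space n}
    (hG : ContDiffAt ℝ 1 G p) : ContDiffAt ℝ 1 (fun q => horizontalPart q (G q)) p := by
  have := contDiffAt_toFrame hG
  unfold horizontalPart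
  exact contDiffAt_ofFrame (by fun_prop)

theorem contDiffAt_metric {G G' : Space n → Space n} {p : Space n}
    (hG : ContDiffAt ℝ 1 G p) (hG' : ContDiffAt ℝ 1 G' p) :
    ContDiffAt ℝ 1 (fun q => metric q (G q) (G' q)) p := by
  have := contDiffAt_toFrame hG
  have := contDiffAt_toFrame hG'
  unfold metric
  fun_prop

theorem contDiffAt_horizontalNormal {G : Space n → Space n} {p : Space n}
    (hG : ContDiffAt ℝ 1 G p) (h : horizontalPart p (G p) ≠ 0) :
    ContDiffAt ℝ 1 (horizontalNormal G) p := by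
  have h1 := contDiffAt_horizontalPart hG
  have h2 := (modulus_pos p).2 h
  have h3 : metric p (horizontalPart p (G p)) (horizontalPart p (G p)) ≠ 0 := fun e => by
    simp [modulus, e] at h2
  exact ((((contDiffAt_metric h1 h1).sqrt h3).inv h2.ne')).smul h1

/-- Where the gradient of `f` has a horizontal part, its opposite unit vector calibrates the
level sets of `f`. -/
theorem isCalibration_horizontalNormal {Ω O : Set (Space n)} {f : Space n → ℝ}
    (hf : IsDefiningFunction Ω f O) (hO : ∀ z ∈ O, horizontalPart z (gradient f z) ≠ 0) :
    IsCalibration f (fun z => -horizontalNormal (gradient f) z) O where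
  contDiffOn z hz := (contDiffAt_horizontalNormal (contDiffAt_gradient (hf.contDiffAt hz))
    (hO z hz)).neg.contDiffWithinAt
  horizontal z _ := neg_mem (horizontalNormal_mem _ z)
  modulus_le z hz := by
    rw [← neg_one_smul ℝ, modulus_smul, modulus_horizontalNormal (hO z hz)]
    norm_num
  fderiv_le z hz w hw hw1 := by
    have h1 := (modulus_pos z).2 (hO z hz)
    have e : fderiv ℝ f z (horizontalNormal (gradient f) z) =
        modulus z (horizontalPart z (gradient f z)) := by
      rw [← metric_gradient, ← metric_horizontalPart (horizontalNormal_mem _ z), metric_comm,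
        horizontalNormal, metric_smul_left, metric_eq_inner, real_inner_self_eq_norm_sq,
        ← modulus_eq_norm]
      field_simp
    rw [map_neg, e, ← metric_gradient f z w, ← metric_horizontalPart hw, metric_eq_inner]
    have h2 := neg_le_of_abs_le (abs_real_inner_le_norm
      (frameVec z (horizontalPart z (gradient f z))) (frameVec z w))
    rw [← modulus_eq_norm, ← modulus_eq_norm] at h2
    nlinarith

theorem divergence_neg {U : Space n → Space n} {p : Space n} (hU : DifferentiableAt ℝ U p) :
    divergence (fun q => -U q) p = -divergence U p := by
  rw [divergence_eq hU, divergence_eq hU.fun_neg, fderiv_fun_neg]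
  simp only [neg_apply, Prod.fst_neg, Prod.snd_neg, Pi.neg_apply, Finset.sum_neg_distrib]
  ring

/-! ### The divergence as a trace -/

theorem ofFrame_add (p c d : Space n) :
    ofFrame p (c + d) = ofFrame p c + ofFrame p d := by
  have h := toFrame_add p (ofFrame p c) (ofFrame p d)
  rw [toFrame_ofFrame, toFrame_ofFrame] at h
  rw [← h, ofFrame_toFrame]

theorem ofFrame_smul (p : Space n) (r : ℝ) (c : Space n) :
    ofFrame p (r • c) = r • ofFrame p c := by
  have h := toFrame_smul p r (ofFrame p c)
  rw [toFrame_ofFrame] at h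
  rw [← h, ofFrame_toFrame]

/-- The covariant derivative `v ↦ D_v U` at `p`, in the orthonormal frame. -/
def covDerivFrame (U : Space n → Space n) (p : Space n) :
    EuclideanSpace ℝ (Fin n ⊕ Fin n ⊕ Unit) →ₗ[ℝ] EuclideanSpace ℝ (Fin n ⊕ Fin n ⊕ Unit) where
  toFun w := frameVec p (covDeriv U p ((frameVec p).symm w))
  map_add' v w := by
    rw [← map_add (frameVec p), map_add (frameVec p).symm]
    congr 1
    unfold covDeriv
    rw [map_add, ← ofFrame_add, toFrame_add]
    congr 1
    generalize toFrame p ((frameVec p).symm v) = a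
    generalize toFrame p ((frameVec p).symm w) = b
    generalize toFrame p (U p) = c
    have : christoffel (a + b) c = christoffel a c + christoffel b c := by
      refine Prod.ext ?_ (Prod.ext ?_ ?_)
      · simp only [christoffel, Prod.snd_add, Prod.fst_add, smul_add, add_smul]
        abel
      · simp only [christoffel, Prod.snd_add, Prod.fst_add, smul_add, add_smul]
        abel
      · simp only [christoffel, Prod.snd_add, Prod.fst_add, Pi.add_apply, add_mul,
          ← Finset.sum_add_distrib]
        exact Finset.sum_congr rfl fun k _ => by ring
    rw [this]
    abel
  map_smul' r v := by
    rw [RingHom.id_apply, ← map_smul (frameVec p), map_smul (frameVec p).symm]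
    congr 1
    unfold covDeriv
    rw [map_smul, ← ofFrame_smul, toFrame_smul]
    congr 1
    generalize toFrame p ((frameVec p).symm v) = a
    generalize toFrame p (U p) = c
    have : christoffel (r • a) c = r • christoffel a c := by
      refine Prod.ext ?_ (Prod.ext ?_ ?_)
      · simp only [christoffel, Prod.smul_snd, Prod.smul_fst, smul_sub, smul_neg, smul_smul,
          smul_eq_mul, mul_comm]
      · simp only [christoffel, Prod.smul_snd, Prod.smul_fst, smul_add, smul_smul,
          smul_eq_mul, mul_comm]
      · simp only [christoffel, Prod.smul_snd, Prod.smul_fst, Pi.smul_apply, smul_eq_mul,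
          Finset.mul_sum]
        exact Finset.sum_congr rfl fun k _ => by ring
    rw [this, smul_add]

theorem inner_covDerivFrame (U : Space n → Space n) (p v : Space n) :
    inner ℝ (frameVec p v) (covDerivFrame U p (frameVec p v)) = metric p (covDeriv U p v) v := by
  rw [metric_eq_inner, real_inner_comm]
  simp [covDerivFrame]

theorem divergence_eq_trace (U : Space n → Space n) (p : Space n) :
    divergence U p = LinearMap.trace ℝ _ (covDerivFrame U p) := by
  rw [LinearMap.trace_eq_sum_inner _ (EuclideanSpace.basisFun _ ℝ)]
  have hX : ∀ k, EuclideanSpace.basisFun (Fin n ⊕ Fin n ⊕ Unit) ℝ (.inl k) =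
      frameVec p (X k p) := fun k => by
    ext i
    rcases i with i | i | i <;> simp [toFrame, X, Pi.single_apply]
  have hY : ∀ k, EuclideanSpace.basisFun (Fin n ⊕ Fin n ⊕ Unit) ℝ (.inr (.inl k)) =
      frameVec p (Y k p) := fun k => by
    ext i
    rcases i with i | i | i <;> simp [toFrame, Y, Pi.single_apply]
  have hT : ∀ k, EuclideanSpace.basisFun (Fin n ⊕ Fin n ⊕ Unit) ℝ (.inr (.inr k)) =
      frameVec p (T p) := fun k => by
    ext i
    rcases i with i | i | i <;> simp [toFrame, T]
  simp only [Fintype.sum_sum_type, hX, hY, hT, inner_covDerivFrame]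
  simp [divergence, add_assoc]

/-- The horizontal normal does not contribute to its divergence in the direction of the gradient:
`⟨D_G ν, G⟩ = 0` because `ν` has constant modulus and is orthogonal to `T`, and because
`⟨ν, D_G T⟩` vanishes by antisymmetry. -/
theorem metric_covDeriv_horizontalNormal {G : Space n → Space n} {p : Space n}
    (hG : ContDiffAt ℝ 1 G p) (h : horizontalPart p (G p) ≠ 0) :
    metric p (covDeriv (horizontalNormal G) p (G p)) (G p) = 0 := by
  set ν := horizontalNormal G with hν
  have hνd : DifferentiableAt ℝ ν p :=
    (contDiffAt_horizontalNormal hG h).differentiableAt one_ne_zero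
  set l := modulus p (horizontalPart p (G p)) with hl
  have hlpos : 0 < l := (modulus_pos p).2 h
  have hnear : ∀ᶠ q in 𝓝 p, horizontalPart q (G q) ≠ 0 :=
    (contDiffAt_horizontalPart hG).continuousAt.eventually_ne h
  have h1 : metric p (covDeriv ν p (G p)) (ν p) = 0 := by
    have e : (fun q => metric q (ν q) (ν q)) =ᶠ[𝓝 p] fun _ => 1 := by
      filter_upwards [hnear] with q hq
      rw [metric_eq_inner, real_inner_self_eq_norm_sq, ← modulus_eq_norm,
        modulus_horizontalNormal hq, one_pow]
    have := fderiv_metric hνd hνd (G p)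
    rw [e.fderiv_eq, metric_comm p (ν p)] at this
    simp at this
    linarith
  have hGν : toFrame p (G p) = l • toFrame p (ν p) + (0, 0, (toFrame p (G p)).2.2) := by
    have : l • ν p = horizontalPart p (G p) := by
      rw [hν, horizontalNormal, smul_smul, mul_inv_cancel₀ hlpos.ne', one_smul]
    rw [← toFrame_smul, this, toFrame_horizontalPart]
    simp
  have h2 : (toFrame p (covDeriv ν p (G p))).2.2 = 0 := by
    have hνf : ∀ q, (toFrame q (ν q)).2.2 = 0 := fun q =>
      mem_horizontal.1 (horizontalNormal_mem G q)
    obtain ⟨L, hL, -⟩ := hasFDerivAt_toFrame hνd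
    have hz : (L (G p)).2.2 = 0 := by
      have h0 : HasFDerivAt (fun q => (toFrame q (ν q)).2.2) _ p := hL.snd.snd
      simp only [hνf] at h0
      simpa using congrArg (fun A : Space n →L[ℝ] ℝ => A (G p))
        (h0.unique (hasFDerivAt_const (0 : ℝ) p))
    rw [covDeriv, toFrame_ofFrame, hL.fderiv, Prod.snd_add, Prod.snd_add, hz, zero_add]
    simp only [christoffel]
    refine Finset.sum_eq_zero fun k _ => ?_
    rw [hGν]
    simp
    ring
  have e : ∀ c, metric p c (G p) = l * metric p c (ν p) +
      (toFrame p c).2.2 * (toFrame p (G p)).2.2 := fun c => by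
    have hν0 : (toFrame p (ν p)).2.2 = 0 := mem_horizontal.1 (horizontalNormal_mem G p)
    unfold metric
    generalize ht : (toFrame p (G p)).2.2 = τ at hGν ⊢
    simp only [hGν, hν0]
    simp [mul_add, Finset.mul_sum, mul_left_comm]
  rw [e, h1, h2]
  simp

/-! ### The boundary as a hypersurface -/

theorem eventually_pos_of_fderiv_pos {E : Type*} [NormedAddCommGroup E] [NormedSpace ℝ E]
    {f : E → ℝ} {z v : E} (hf : DifferentiableAt ℝ f z) (hz : f z = 0) (hv : 0 < fderiv ℝ f z v) :
    ∀ᶠ s in 𝓝[>] (0 : ℝ), 0 < f (z + s • v) := by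
  have h1 : HasDerivAt (fun s : ℝ => z + s • v) v 0 := by
    simpa using ((hasDerivAt_id (0 : ℝ)).smul_const v).const_add z
  have h2 : HasDerivAt (fun s : ℝ => f (z + s • v)) (fderiv ℝ f z v) 0 := by
    refine HasFDerivAt.comp_hasDerivAt (0 : ℝ) ?_ h1
    simpa using hf.hasFDerivAt
  filter_upwards [h2.tendsto_slope_zero_right.eventually_const_lt hv, self_mem_nhdsWithin]
    with s hs (hs0 : 0 < s)
  simp only [zero_add, zero_smul, add_zero, hz, sub_zero, smul_eq_mul] at hs
  exact pos_of_mul_pos_right hs (inv_pos.2 hs0).le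

theorem tendsto_add_smul_nhdsGT {E : Type*} [NormedAddCommGroup E] [NormedSpace ℝ E] (z v : E) :
    Tendsto (fun s : ℝ => z + s • v) (𝓝[>] 0) (𝓝 z) := by
  have h : Continuous fun s : ℝ => z + s • v := by fun_prop
  simpa using (h.tendsto 0).mono_left nhdsWithin_le_nhds

theorem IsDefiningFunction.differentiableAt {Ω O : Set (Space n)} {f : Space n → ℝ}
    (h : IsDefiningFunction Ω f O) {z : Space n} (hz : z ∈ O) : DifferentiableAt ℝ f z :=
  (h.contDiffAt hz).differentiableAt two_ne_zero

theorem IsDefiningFunction.eventually_mem {Ω O : Set (Space n)} {f : Space n → ℝ}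
    (h : IsDefiningFunction Ω f O) {z v : Space n} (hz : z ∈ O) (hfz : f z = 0)
    (hv : 0 < fderiv ℝ f z v) : ∀ᶠ s in 𝓝[>] (0 : ℝ), z + s • v ∈ Ω := by
  filter_upwards [eventually_pos_of_fderiv_pos (h.differentiableAt hz) hfz hv,
    (tendsto_add_smul_nhdsGT z v).eventually_mem (h.isOpen.mem_nhds hz)] with s hs hsO
  exact h.mem_of_pos _ hsO hs

theorem IsDefiningFunction.eventually_notMem {Ω O : Set (Space n)} {f : Space n → ℝ}
    (h : IsDefiningFunction Ω f O) {z v : Space n} (hz : z ∈ O) (hfz : f z = 0)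
    (hv : fderiv ℝ f z v < 0) : ∀ᶠ s in 𝓝[>] (0 : ℝ), z + s • v ∉ Ω := by
  have hd := h.differentiableAt hz
  have h1 := eventually_pos_of_fderiv_pos (f := fun y => -f y) hd.fun_neg (by simp [hfz])
    (v := v) (by rw [fderiv_fun_neg]; simpa using hv)
  filter_upwards [h1, (tendsto_add_smul_nhdsGT z v).eventually_mem (h.isOpen.mem_nhds hz)]
    with s hs hsO
  exact h.notMem_of_neg _ hsO (by linarith)

theorem IsDefiningFunction.exists_fderiv_pos {Ω O : Set (Space n)} {f : Space n → ℝ}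
    (h : IsDefiningFunction Ω f O) {z : Space n} (hz : z ∈ O) : ∃ v, 0 < fderiv ℝ f z v := by
  obtain ⟨v, hv⟩ : ∃ v, fderiv ℝ f z v ≠ 0 := by
    by_contra! h0
    exact h.fderiv_ne z hz (ContinuousLinearMap.ext h0)
  rcases hv.lt_or_gt with hv | hv
  · exact ⟨-v, by rw [map_neg]; linarith⟩
  · exact ⟨v, hv⟩

/-- In `O` the boundary of `Ω` is the level set `{f = 0}`. -/
theorem IsDefiningFunction.mem_frontier_iff {Ω O : Set (Space n)} {f : Space n → ℝ}
    (h : IsDefiningFunction Ω f O) {z : Space n} (hz : z ∈ O) : z ∈ frontier Ω ↔ f z = 0 := by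
  have hcont := (h.differentiableAt hz).continuousAt
  constructor
  · intro hfr
    rw [frontier_eq_closure_inter_closure] at hfr
    rcases lt_trichotomy (f z) 0 with hlt | h0 | hgt
    · have : Ωᶜ ∈ 𝓝 z := by
        filter_upwards [hcont.eventually_lt continuousAt_const hlt, h.isOpen.mem_nhds hz]
          with y hy hyO
        exact h.notMem_of_neg y hyO hy
      obtain ⟨y, hy, hy'⟩ := mem_closure_iff_nhds.1 hfr.1 _ this
      exact absurd hy' hy
    · exact h0
    · have : Ω ∈ 𝓝 z := by
        filter_upwards [continuousAt_const.eventually_lt hcont hgt, h.isOpen.mem_nhds hz]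
          with y hy hyO
        exact h.mem_of_pos y hyO hy
      obtain ⟨y, hy, hy'⟩ := mem_closure_iff_nhds.1 hfr.2 _ this
      exact absurd hy hy'
  · intro h0
    obtain ⟨v, hv⟩ := h.exists_fderiv_pos hz
    rw [frontier_eq_closure_inter_closure]
    refine ⟨mem_closure_of_tendsto (tendsto_add_smul_nhdsGT z v) (h.eventually_mem hz h0 hv),
      mem_closure_of_tendsto (tendsto_add_smul_nhdsGT z (-v)) (h.eventually_notMem hz h0 ?_)⟩
    rw [map_neg]
    linarith

theorem IsDefiningFunction.mem_tangentSpace_iff {Ω O : Set (Space n)} {f : Space n → ℝ}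
    (h : IsDefiningFunction Ω f O) {z : Space n} (hz : z ∈ O) (hfz : f z = 0) {v : Space n} :
    v ∈ tangentSpace (frontier Ω) z ↔ fderiv ℝ f z v = 0 := by
  constructor
  · rintro ⟨γ, hγ0, hγ, hγS⟩
    have h1 : HasDerivAt (fun s => f (γ s)) (fderiv ℝ f z v) 0 := by
      refine HasFDerivAt.comp_hasDerivAt (0 : ℝ) ?_ hγ
      rw [hγ0]
      exact (h.differentiableAt hz).hasFDerivAt
    have h2 : (fun s => f (γ s)) =ᶠ[𝓝 0] fun _ => 0 := by
      filter_upwards [hγS, hγ.continuousAt.eventually_mem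
        (h.isOpen.mem_nhds (by rwa [hγ0]))] with s hs hsO
      exact (h.mem_frontier_iff hsO).1 hs
    exact h1.unique ((hasDerivAt_const (0 : ℝ) (0 : ℝ)).congr_of_eventuallyEq h2)
  · intro hv
    have hs : HasStrictFDerivAt f (fderiv ℝ f z) z :=
      (h.contDiffAt hz).hasStrictFDerivAt two_ne_zero
    have hr : (fderiv ℝ f z).range = ⊤ := by
      refine LinearMap.range_eq_top.2 (LinearMap.surjective ?_)
      intro h0
      exact h.fderiv_ne z hz (ContinuousLinearMap.coe_injective h0)
    let w : (fderiv ℝ f z).ker := ⟨v, hv⟩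
    have hw : HasDerivAt (fun s : ℝ => s • w) w 0 := by
      simpa using (hasDerivAt_id (0 : ℝ)).smul_const w
    have hi : HasFDerivAt (hs.implicitFunction f (fderiv ℝ f z) hr (f z))
        (fderiv ℝ f z).ker.subtypeL ((0 : ℝ) • w) := by
      rw [zero_smul]
      exact (hs.to_implicitFunction hr).hasFDerivAt
    have hγ : HasDerivAt (fun s : ℝ => hs.implicitFunction f (fderiv ℝ f z) hr (f z) (s • w)) v 0 :=
      (hi.comp_hasDerivAt (0 : ℝ) hw :)
    have hγ0 : hs.implicitFunction f (fderiv ℝ f z) hr (f z) ((0 : ℝ) • w) = z := by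
      rw [zero_smul]
      exact hs.implicitFunction_apply_image hr
    refine ⟨_, hγ0, hγ, ?_⟩
    have ht : Tendsto (fun s : ℝ => (f z, s • w)) (𝓝 0) (𝓝 (f z, 0)) := by
      have : Continuous fun s : ℝ => (f z, s • w) := by fun_prop
      simpa using this.tendsto 0
    filter_upwards [ht.eventually (hs.map_implicitFunction_eq hr),
      hγ.continuousAt.eventually_mem (h.isOpen.mem_nhds (by rwa [hγ0]))] with s hs1 hsO
    rw [h.mem_frontier_iff hsO, hs1, hfz]

theorem IsDefiningFunction.gradient_ne_zero {Ω O : Set (Space n)} {f : Space n → ℝ}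
    (h : IsDefiningFunction Ω f O) {z : Space n} (hz : z ∈ O) : gradient f z ≠ 0 := by
  obtain ⟨v, hv⟩ := h.exists_fderiv_pos hz
  intro h0
  rw [← metric_gradient, h0, metric_eq_inner, map_zero, inner_zero_left] at hv
  exact lt_irrefl _ hv

/-- Off the singular set, the gradient of a defining function is not vertical. -/
theorem IsDefiningFunction.horizontalPart_gradient_ne_zero {Ω O : Set (Space n)} {f : Space n → ℝ}
    (h : IsDefiningFunction Ω f O) {z : Space n} (hz : z ∈ O)
    (hreg : z ∈ frontier Ω \ singularSet (frontier Ω)) :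
    horizontalPart z (gradient f z) ≠ 0 := by
  intro h0
  refine hreg.2 ⟨hreg.1, ?_⟩
  have e : toFrame z (horizontalPart z (gradient f z)) = 0 := by
    rw [h0]
    simp [toFrame]
  rw [toFrame_horizontalPart, Prod.mk_eq_zero, Prod.mk_eq_zero] at e
  have hm : ∀ v, fderiv ℝ f z v = (toFrame z (gradient f z)).2.2 * (toFrame z v).2.2 := fun v => by
    rw [← metric_gradient]
    simp [metric, e.1, e.2.1]
  have hne : (toFrame z (gradient f z)).2.2 ≠ 0 := fun h1 =>
    h.fderiv_ne z hz (ContinuousLinearMap.ext fun v => by simp [hm v, h1])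
  ext v
  rw [h.mem_tangentSpace_iff hz ((h.mem_frontier_iff hz).1 hreg.1), hm v, SetLike.mem_coe,
    mem_horizontal, mul_eq_zero, or_iff_right hne]

/-- The unit vector in the direction of the gradient. -/
def unitGradient (f : Space n → ℝ) (z : Space n) : Space n :=
  (modulus z (gradient f z))⁻¹ • gradient f z

/-- Two defining functions have positively proportional gradients at a boundary point: the
gradients have the same orthogonal complement and both point into `Ω`. -/
theorem IsDefiningFunction.unitGradient_eq {Ω O O' : Set (Space n)} {f f' : Space n → ℝ}
    (h : IsDefiningFunction Ω f O) (h' : IsDefiningFunction Ω f' O') {z : Space n} (hz : z ∈ O)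
    (hz' : z ∈ O') (hfr : z ∈ frontier Ω) : unitGradient f' z = unitGradient f z := by
  have hfz := (h.mem_frontier_iff hz).1 hfr
  have hfz' := (h'.mem_frontier_iff hz').1 hfr
  have hker : ∀ v, fderiv ℝ f z v = 0 ↔ fderiv ℝ f' z v = 0 := fun v => by
    rw [← h.mem_tangentSpace_iff hz hfz, h'.mem_tangentSpace_iff hz' hfz']
  set G := gradient f z with hG
  set G' := gradient f' z with hG'
  have hGG : 0 < metric z G G := by
    have := (modulus_pos z).2 (h.gradient_ne_zero hz)
    rw [metric_eq_inner, real_inner_self_eq_norm_sq, ← modulus_eq_norm]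
    positivity
  set c := metric z G G' / metric z G G with hc
  have hGv : G' - c • G = 0 := by
    have h1 : metric z G (G' - c • G) = 0 := by
      rw [metric_eq_inner, map_sub, map_smul, inner_sub_right, real_inner_smul_right,
        ← metric_eq_inner, ← metric_eq_inner, hc, div_mul_cancel₀ _ hGG.ne', sub_self]
    have h2 : metric z G' (G' - c • G) = 0 := by
      rw [hG', metric_gradient, ← hker, ← metric_gradient]
      exact h1
    have h3 : metric z (G' - c • G) (G' - c • G) = 0 := by
      rw [metric_eq_inner, map_sub, inner_sub_left, ← map_sub, ← metric_eq_inner, h2, map_smul,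
        real_inner_smul_left, ← metric_eq_inner, h1]
      simp
    rw [metric_eq_inner, inner_self_eq_zero] at h3
    exact (LinearEquiv.map_eq_zero_iff _).1 h3
  have hGc : G' = c • G := sub_eq_zero.1 hGv
  have hc0 : c ≠ 0 := fun h0 => h'.gradient_ne_zero hz' (by rw [← hG', hGc, h0, zero_smul])
  have hcpos : 0 < c := by
    by_contra hneg
    have hneg : c < 0 := lt_of_le_of_ne (not_lt.1 hneg) hc0
    have h1 := h.eventually_mem hz hfz (v := G) (by rwa [← metric_gradient])
    have h2 := h'.eventually_notMem hz' hfz' (v := G) (by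
      rw [← metric_gradient, ← hG', hGc, metric_smul_left]
      exact mul_neg_of_neg_of_pos hneg hGG)
    obtain ⟨s, hs1, hs2⟩ := (h1.and h2).exists
    exact hs2 hs1
  rw [unitGradient, unitGradient, ← hG, ← hG', hGc, modulus_smul, abs_of_pos hcpos, smul_smul,
    mul_inv_rev, mul_assoc, inv_mul_cancel₀ hcpos.ne', mul_one]

theorem IsDefiningFunction.modulus_gradient_pos {Ω O : Set (Space n)} {f : Space n → ℝ}
    (h : IsDefiningFunction Ω f O) {z : Space n} (hz : z ∈ O) : 0 < modulus z (gradient f z) :=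
  (modulus_pos z).2 (h.gradient_ne_zero hz)

theorem IsDefiningFunction.modulus_unitGradient {Ω O : Set (Space n)} {f : Space n → ℝ}
    (h : IsDefiningFunction Ω f O) {z : Space n} (hz : z ∈ O) : modulus z (unitGradient f z) = 1 := by
  have := h.modulus_gradient_pos hz
  rw [unitGradient, modulus_smul, abs_of_pos (inv_pos.2 this), inv_mul_cancel₀ this.ne']

/-- A unit vector `N` extends to an orthonormal basis, in which it has the index `none`. -/
theorem exists_orthonormalBasis_none_eq {p N : Space n} (hN : modulus p N = 1) :
    ∃ b : OrthonormalBasis (Option (Fin (2 * n))) ℝ (EuclideanSpace ℝ (Fin n ⊕ Fin n ⊕ Unit)),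
      b none = frameVec p N := by
  have hcard : Module.finrank ℝ (EuclideanSpace ℝ (Fin n ⊕ Fin n ⊕ Unit)) =
      Fintype.card (Option (Fin (2 * n))) := by
    simp
    ring
  obtain ⟨b, hb⟩ := Orthonormal.exists_orthonormalBasis_extension_of_card_eq hcard
    (v := fun _ => frameVec p N) (s := {none}) (by
      refine ⟨fun i => ?_, fun i j hij => absurd (Subsingleton.elim i j) hij⟩
      change ‖frameVec p N‖ = 1
      rw [← modulus_eq_norm, hN])
  exact ⟨b, hb none rfl⟩

/-- The divergence of `ν_H` along the boundary is the divergence in the ambient space of the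
horizontal normal of the level sets of a defining function. The orthonormal basis of the tangent
space is completed by the normal, which does not contribute to the trace. -/
theorem IsDefiningFunction.hasDivergenceAlong {Ω O : Set (Space n)} {f : Space n → ℝ}
    {N : Space n → Space n} (h : IsDefiningFunction Ω f O) {p : Space n} (hp : p ∈ O)
    (hreg : p ∈ frontier Ω \ singularSet (frontier Ω))
    (hN : ∀ q ∈ O, q ∈ frontier Ω → N q = unitGradient f q) :
    HasDivergenceAlong (frontier Ω) (horizontalNormal N) p
      (divergence (horizontalNormal (gradient f)) p) := by
  set ν := horizontalNormal (gradient f) with hν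
  have hfp := (h.mem_frontier_iff hp).1 hreg.1
  have hne := h.horizontalPart_gradient_ne_zero hp hreg
  have hG := contDiffAt_gradient (h.contDiffAt hp)
  have hνd : DifferentiableAt ℝ ν p := (contDiffAt_horizontalNormal hG hne).differentiableAt
    one_ne_zero
  have hNν : ∀ q ∈ O, q ∈ frontier Ω → horizontalNormal N q = ν q := fun q hq hqS =>
    horizontalNormal_congr (inv_pos.2 (h.modulus_gradient_pos hq)) (hN q hq hqS)
  obtain ⟨b, hb⟩ := exists_orthonormalBasis_none_eq (h.modulus_unitGradient hp)
  have hbe : ∀ i, b i = frameVec p ((frameVec p).symm (b i)) := fun i => by simp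
  refine ⟨covDeriv ν p, fun i => (frameVec p).symm (b (some i)),
    ⟨fderiv ℝ (fun q => toFrame q (ν q)) p, ?_, fun v _ => ?_⟩, ⟨fun i => ?_, fun i j => ?_⟩, ?_⟩
  · obtain ⟨L, hL, -⟩ := hasFDerivAt_toFrame hνd
    rw [hL.fderiv]
    refine hL.hasFDerivWithinAt.congr_of_eventuallyEq ?_ (by rw [hNν p hp hreg.1])
    filter_upwards [self_mem_nhdsWithin, nhdsWithin_le_nhds (h.isOpen.mem_nhds hp)] with q hq hqO
    rw [hNν q hqO hq]
  · rw [hNν p hp hreg.1, covDeriv]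
  · rw [h.mem_tangentSpace_iff hp hfp, ← metric_gradient]
    have h1 : metric p (unitGradient f p) ((frameVec p).symm (b (some i))) = 0 := by
      rw [metric_eq_inner, ← hb, ← hbe, b.inner_eq_ite]
      simp
    rw [unitGradient, metric_smul_left, mul_eq_zero] at h1
    exact h1.resolve_left (inv_pos.2 (h.modulus_gradient_pos hp)).ne'
  · rw [metric_eq_inner, ← hbe, ← hbe, b.inner_eq_ite]
    simp
  · have hzero : metric p (covDeriv ν p (unitGradient f p)) (unitGradient f p) = 0 := by
      have h1 := metric_covDeriv_horizontalNormal hG hne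
      rw [← inner_covDerivFrame] at h1 ⊢
      rw [unitGradient, map_smul, map_smul, real_inner_smul_left, real_inner_smul_right, h1]
      simp
    rw [divergence_eq_trace, LinearMap.trace_eq_sum_inner _ b, Fintype.sum_option, hb,
      inner_covDerivFrame, hzero, zero_add]
    refine Finset.sum_congr rfl fun i _ => ?_
    rw [hbe (some i), inner_covDerivFrame]

end Heisenberg

end

open Heisenberg in
theorem mainTheorem2 (n : ℕ) (hn : 1 ≤ n) (Ω : Set (Heisenberg.Space n))
    (hfin : Heisenberg.IsOfFinitePerimeter Ω) (hbdry : Heisenberg.HasC2Boundary Ω)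
    (hstat : Heisenberg.IsStationary Ω) :
    ∃ N : Heisenberg.Space n → Heisenberg.Space n,
      Heisenberg.IsInnerUnitNormal Ω N ∧
        Heisenberg.HasConstantMeanCurvature (frontier Ω) N := by
  classical
  have hloc : ∀ p : Space n, ∃ (f : Space n → ℝ) (O : Set (Space n)),
      p ∈ frontier Ω → p ∈ O ∧ IsDefiningFunction Ω f O := by
    intro p
    by_cases hp : p ∈ frontier Ω
    · obtain ⟨f, W, h1, h2, h3, h4, h5, h6⟩ := hbdry p hp
      exact ⟨f, W, fun _ => ⟨h2, h1, h3, h4, h5, h6⟩⟩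
    · exact ⟨0, ∅, fun h => absurd h hp⟩
  choose f O hfO using hloc
  have hN : ∀ p ∈ frontier Ω, ∀ q ∈ O p, q ∈ frontier Ω →
      unitGradient (f q) q = unitGradient (f p) q := fun p hp q hq hqS =>
    (hfO p hp).2.unitGradient_eq (hfO q hqS).2 hq (hfO q hqS).1 hqS
  refine ⟨fun p => unitGradient (f p) p, fun p hp => ?_, ?_⟩
  · obtain ⟨hpO, h⟩ := hfO p hp
    have hfp := (h.mem_frontier_iff hpO).1 hp
    have hpos := h.modulus_gradient_pos hpO
    refine ⟨h.modulus_unitGradient hpO, fun v hv => ?_, h.eventually_mem hpO hfp ?_⟩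
    · dsimp only
      rw [unitGradient, metric_smul_left, metric_gradient, (h.mem_tangentSpace_iff hpO hfp).1 hv,
        mul_zero]
    · dsimp only
      rw [unitGradient, map_smul, ← metric_gradient, metric_eq_inner, real_inner_self_eq_norm_sq,
        ← modulus_eq_norm, smul_eq_mul]
      positivity
  · have hn0 : (n : ℝ) ≠ 0 := by
      have : n ≠ 0 := by omega
      exact_mod_cast this
    set d : Space n → ℝ := fun p => divergence (horizontalNormal (gradient (f p))) p with hd
    -- calibrated neighborhood of a regular boundary point
    have hcal : ∀ p ∈ frontier Ω \ singularSet (frontier Ω), ∃ B, p ∈ B ∧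
        IsDefiningFunction Ω (f p) B ∧
        IsCalibration (f p) (fun z => -horizontalNormal (gradient (f p)) z) B ∧
        divergence (fun z => -horizontalNormal (gradient (f p)) z) p = -d p := by
      intro p hp
      obtain ⟨hpO, h⟩ := hfO p hp.1
      have hne := h.horizontalPart_gradient_ne_zero hpO hp
      have hG := contDiffAt_gradient (h.contDiffAt hpO)
      obtain ⟨B, hB, hBo, hpB⟩ := eventually_nhds_iff.1
        (((contDiffAt_horizontalPart hG).continuousAt.eventually_ne hne).and
          (h.isOpen.eventually_mem hpO))
      have hB' := h.mono hBo fun z hz => (hB z hz).2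
      exact ⟨B, hpB, hB', isCalibration_horizontalNormal hB' fun z hz => (hB z hz).1,
        divergence_neg ((contDiffAt_horizontalNormal hG hne).differentiableAt one_ne_zero)⟩
    have hle : ∀ p ∈ frontier Ω \ singularSet (frontier Ω),
        ∀ q ∈ frontier Ω \ singularSet (frontier Ω), d q ≤ d p := by
      intro p hp q hq
      by_cases hpq : p = q
      · rw [hpq]
      · obtain ⟨B, hpB, hB, hVB, eB⟩ := hcal p hp
        obtain ⟨B', hqB', hB', hVB', eB'⟩ := hcal q hq
        have := divergence_calibration_le hfin hstat hB hB' hVB hVB' hpB hqB'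
          ((hB.mem_frontier_iff hpB).1 hp.1) ((hB'.mem_frontier_iff hqB').1 hq.1) hpq
        rw [eB, eB'] at this
        linarith
    rcases (frontier Ω \ singularSet (frontier Ω)).eq_empty_or_nonempty with he | ⟨p₀, hp₀⟩
    · exact ⟨0, fun p hp => by simp [he] at hp⟩
    · refine ⟨-d p₀ / (2 * n), fun p hp => ?_⟩
      obtain ⟨hpO, h⟩ := hfO p hp.1
      have e : -2 * (n : ℝ) * (-d p₀ / (2 * n)) = d p := by
        rw [(hle p₀ hp₀ p hp).antisymm (hle p hp p₀ hp₀)]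
        field_simp
      rw [HasMeanCurvatureAt, e]
      exact h.hasDivergenceAlong hpO hp (hN p hp.1)
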